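/- A loop is an algebra $(Q,\cdot,\backslash,/,1)$ satisfying $(xy)/y=x$, $(x/y)y=x$, $x\backslash(xy)=y$, $x(x\backslash y)=y$, $1x=x1=x$. It is a Moufang loop if $x(y(xz))=((xy)x)z$ holds in it, and an A-loop if all its inner mappings (the elements of the group generated by $T(x)=L_x^{-1}R_x$, $R(x,y)=R_{xy}^{-1}R_yR_x$, $L(x,y)=L_{xy}^{-1}L_xL_y$, where $L_xy=xy$ and $R_xy=yx$) are automorphisms. The lower central series of $Q$ is $Q_0=Q$, with $Q_{k+1}$ the intersection of all normal subloops $K$ of $Q$ such that $Q_kK/K$ lies in the centre of $Q/K$; $Q$ is centrally nilpotent of class $n$ if $n$ is the least index with $Q_n=\{1\}$. The associators $[a,b,c]$, $\alpha(a,b,c)$, $\beta(a,b,c)$ are defined by $$(ab)c=(a(bc))\,[a,b,c],\qquad (ab)c=(a\,\alpha(a,b,c))(bc),\qquad c(ba)=(cb)(\beta(a,b,c)\,a).$$ For $A\in\{[\cdot,\cdot,\cdot],\alpha,\beta\}$ put $w^A_0=x_0$ and $w^A_{k+1}=A(w^A_k,x_{2k+1},x_{2k+2})$, so that $w^A_1=A(x_0,x_1,x_2)$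 and $w^A_n$ is a word in the $2n+1$ variables $x_0,\dots,x_{2n}$. The identity $w^A_n=1$ is called the associator identity of weight $n$, of type $(\mu)$, $(\alpha)$, $(\beta)$ respectively. A basis of the identities of $Q$ is a set $B$ of identities that hold in $Q$ such that every identity of $Q$ holds in every loop satisfying $B$. **Theorem.** Let $Q$ be a centrally nilpotent loop of class $n$. 1. If $Q$ is a Moufang loop, then the identities of $Q$ have a finite basis consisting of the associator identity of type $(\mu)$ of weight $n$ (in $2n+1$ variables) and finitely many identities, each in at most $2n$ variables. 2. If $Q$ is an A-loop, then the identities of $Q$ have a finite basis consisting of the associator identity of type $(\alpha)$ of weight $n$ (in $2n+1$ variables) and finitely many identities, each in at most $2n$ variables; and likewise with type $(\beta)$ in place of type $(\alpha)$. -/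

import Mathlib

universe u v

namespace LoopTheory

/-- A loop as an algebra `(Q, *, \, /, 1)`: `ldiv a b` is `a \ b`, the unique solution `x` of
`a * x = b`, and `a / b` is the unique solution `x` of `x * b = a`. -/
class Loop (Q : Type u) extends Mul Q, One Q, Div Q where
  ldiv : Q → Q → Q
  mul_div_cancel : ∀ x y : Q, (x * y) / y = x
  div_mul_cancel : ∀ x y : Q, (x / y) * y = x
  ldiv_mul_cancel : ∀ x y : Q, ldiv x (x * y) = y
  mul_ldiv_cancel : ∀ x y : Q, x * ldiv x y = y
  one_mul : ∀ x : Q, 1 * x = x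
  mul_one : ∀ x : Q, x * 1 = x

section Basic

variable {Q : Type u} [Loop Q]

/-- The left translation `L(x) : y ↦ x * y`. -/
def leftTrans (x : Q) : Equiv.Perm Q where
  toFun y := x * y
  invFun y := Loop.ldiv x y
  left_inv y := Loop.ldiv_mul_cancel x y
  right_inv y := Loop.mul_ldiv_cancel x y

/-- The right translation `R(x) : y ↦ y * x`. -/
def rightTrans (x : Q) : Equiv.Perm Q where
  toFun y := y * x
  invFun y := y / x
  left_inv y := Loop.mul_div_cancel y x
  right_inv y := Loop.div_mul_cancel y x

/-- `T(x) = L(x)⁻¹ R(x)`; products of permutations are compositions. -/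
def innerT (x : Q) : Equiv.Perm Q := (leftTrans x)⁻¹ * rightTrans x

/-- `R(x, y) = R(xy)⁻¹ R(y) R(x)`. -/
def innerR (x y : Q) : Equiv.Perm Q := (rightTrans (x * y))⁻¹ * rightTrans y * rightTrans x

/-- `L(x, y) = L(xy)⁻¹ L(x) L(y)`. -/
def innerL (x y : Q) : Equiv.Perm Q := (leftTrans (x * y))⁻¹ * leftTrans x * leftTrans y

variable (Q) in
/-- The inner mapping group, generated by all `T(x)`, `R(x, y)`, `L(x, y)`. -/
def innerMappingGroup : Subgroup (Equiv.Perm Q) :=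
  Subgroup.closure
    ({φ | ∃ x, φ = innerT x} ∪ {φ | ∃ x y, φ = innerR x y} ∪ {φ | ∃ x y, φ = innerL x y})

variable (Q) in
/-- A Moufang loop. -/
def IsMoufang : Prop := ∀ x y z : Q, x * (y * (x * z)) = ((x * y) * x) * z

variable (Q) in
/-- An A-loop: every inner mapping is an automorphism. -/
def IsALoop : Prop := ∀ φ ∈ innerMappingGroup Q, ∀ x y : Q, φ (x * y) = φ x * φ y

/-- `H` is a subloop. -/
structure IsSubloop (H : Set Q) : Prop where
  one_mem : 1 ∈ H
  mul_mem : ∀ x ∈ H, ∀ y ∈ H, x * y ∈ H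
  ldiv_mem : ∀ x ∈ H, ∀ y ∈ H, Loop.ldiv x y ∈ H
  div_mem : ∀ x ∈ H, ∀ y ∈ H, x / y ∈ H

/-- `H` is a normal subloop: `xH = Hx`, `x(yH) = (xy)H`, `H(xy) = (Hx)y`. -/
structure IsNormalSubloop (H : Set Q) : Prop extends IsSubloop H where
  comm : ∀ x : Q, (fun h => x * h) '' H = (fun h => h * x) '' H
  left : ∀ x y : Q, (fun h => x * (y * h)) '' H = (fun h => (x * y) * h) '' H
  right : ∀ x y : Q, (fun h => h * (x * y)) '' H = (fun h => (h * x) * y) '' H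

/-- For a normal subloop `K`: the cosets `aK` and `bK` coincide. -/
def CongrMod (K : Set Q) (a b : Q) : Prop := Loop.ldiv a b ∈ K

/-- For a normal subloop `K`: the coset `aK` lies in the centre of `Q / K`, that is, it commutes
with every coset and associates with any two cosets, in each of the three positions. -/
def CentralMod (K : Set Q) (a : Q) : Prop :=
  ∀ x y : Q, CongrMod K (a * x) (x * a) ∧
    CongrMod K ((a * x) * y) (a * (x * y)) ∧
    CongrMod K ((x * a) * y) (x * (a * y)) ∧
    CongrMod K ((x * y) * a) (x * (y * a))

variable (Q) in
/-- The lower central series: `Q₀ = Q`, and `Qₖ₊₁` is the intersection of all normal subloops `K`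
such that `QₖK / K` is contained in the centre of `Q / K`. -/
def lowerCentralSeries : ℕ → Set Q
  | 0 => Set.univ
  | k + 1 => ⋂₀ {K | IsNormalSubloop K ∧ ∀ a ∈ lowerCentralSeries k, CentralMod K a}

variable (Q) in
/-- `Q` is centrally nilpotent of class `n`: `n` is the least index with `Qₙ = {1}`. -/
def IsCentrallyNilpotentOfClass (n : ℕ) : Prop :=
  lowerCentralSeries Q n = {1} ∧ ∀ m < n, lowerCentralSeries Q m ≠ {1}

end Basic

/-- Loop terms in the variables `x₀, x₁, x₂, …`. -/
inductive Term : Type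
  | var : ℕ → Term
  | one : Term
  | mul : Term → Term → Term
  | ldiv : Term → Term → Term
  | rdiv : Term → Term → Term

namespace Term

/-- The set of variables occurring in a term. -/
def vars : Term → Finset ℕ
  | var i => {i}
  | one => ∅
  | mul s t => s.vars ∪ t.vars
  | ldiv s t => s.vars ∪ t.vars
  | rdiv s t => s.vars ∪ t.vars

/-- The value of a term in a loop. -/
def eval {Q : Type u} [Loop Q] (f : ℕ → Q) : Term → Q
  | var i => f i
  | one => 1
  | mul s t => s.eval f * t.eval f
  | ldiv s t => Loop.ldiv (s.eval f) (t.eval f)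
  | rdiv s t => s.eval f / t.eval f

/-- The associator `[a, b, c]`: the solution `x` of `(ab)c = (a(bc))x`. -/
def assocMu (a b c : Term) : Term := ldiv (mul a (mul b c)) (mul (mul a b) c)

/-- The associator `α(a, b, c)`: the solution `x` of `(ab)c = (ax)(bc)`. -/
def assocAlpha (a b c : Term) : Term := ldiv a (rdiv (mul (mul a b) c) (mul b c))

/-- The associator `β(a, b, c)`: the solution `x` of `c(ba) = (cb)(xa)`. -/
def assocBeta (a b c : Term) : Term := rdiv (ldiv (mul c b) (mul c (mul b a))) a

/-- The associator word of weight `n` in the variables `x₀, …, x₂ₙ` built from a ternary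
associator `A`: `A(x₀, x₁, x₂)` in weight `1`, and `A(w, x₂ₙ₊₁, x₂ₙ₊₂)` in weight `n + 1`, where
`w` is the word of weight `n`. (In weight `0` it is `x₀`.) -/
def assocWord (A : Term → Term → Term → Term) : ℕ → Term
  | 0 => var 0
  | n + 1 => A (assocWord A n) (var (2 * n + 1)) (var (2 * n + 2))

end Term

/-- A formal identity `lhs = rhs` between loop terms. -/
structure Identity : Type where
  lhs : Term
  rhs : Term

/-- The set of variables occurring in an identity. -/
def Identity.vars (e : Identity) : Finset ℕ := e.lhs.vars ∪ e.rhs.vars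

/-- The identity holds in the loop `Q`. -/
def Identity.HoldsIn (e : Identity) (Q : Type u) [Loop Q] : Prop :=
  ∀ f : ℕ → Q, e.lhs.eval f = e.rhs.eval f

/-- The associator identity `w = 1` of weight `n`. -/
def assocIdentity (A : Term → Term → Term → Term) (n : ℕ) : Identity :=
  ⟨Term.assocWord A n, Term.one⟩

/-- `B` is a basis of the identities of `Q`: the members of `B` hold in `Q`, and every identity of
`Q` is a consequence of `B`, i.e. it holds in every loop in which all members of `B` hold. -/
def IsBasisOfIdentities (Q : Type u) [Loop Q] (B : Set Identity) : Prop :=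
  (∀ b ∈ B, b.HoldsIn Q) ∧
    ∀ e : Identity, e.HoldsIn Q →
      ∀ (M : Type v) [Loop M], (∀ b ∈ B, b.HoldsIn M) → e.HoldsIn M

end LoopTheory

/-! Call a loop controlled with parameter `m` if its translations are induced by a group `Γ` of
nilpotency class at most `m`, and if for every generating set the translations by its elements
generate a group that moves `1` to every element. In a class of controlled loops given by identities
`B`, every identity follows from `B` and finitely many identities in `m` variables.

The reduction to `m` variables (`eval_eq_one_of_controlled`) takes a word `w` in more than `m`
variables that becomes trivial whenever one of its variables is set to `1`. The values of `w` on the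
cube obtained by switching variables on and off are `g ω • 1`, where `g` is a polynomial map from
the cube to `Γ`. Away from the top vertex, `g` takes values in the stabilizer of `1`; at the top
vertex it therefore lies in the stabilizer up to a factor in the `m`-th term of the lower central
series, which is trivial. Finiteness (`exists_finite_of_controlled`) comes from the ascending chain
condition for subgroups of finitely generated nilpotent groups.

It remains to show that nilpotent Moufang loops and A-loops of class `n` are controlled with `m = 2
* n`. Elements of `Γ` that are trivial modulo one term of a central series multiply by an affine
central-valued function modulo the next; one commutator makes this function constant and a second
one makes it trivial, so each central layer costs two commutators. For A-loops `Γ` is the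
multiplication group; for Moufang loops it is a group of autotopisms. Transitivity is direct in
Moufang loops and needs a finer filtration (`commAssocCon`) in A-loops.

Nilpotency of class at most `n` is itself expressed by the iterated words of weight `n` in
commutators and associators. Each commutator saves a variable, so only the pure associator word
needs `2 * n + 1` of them. -/

namespace LoopTheory

/-! ### Commutators in the lower central series. -/

section GroupTheory

open Subgroup
open scoped commutatorElement

/-- The three subgroups lemma modulo a normal subgroup. -/
theorem commutator_commutator_le_of_rotate {G : Type*} [Group G] {A B C N : Subgroup G} [N.Normal]
    (h1 : ⁅⁅B, C⁆, A⁆ ≤ N) (h2 : ⁅⁅C, A⁆, B⁆ ≤ N) : ⁅⁅A, B⁆, C⁆ ≤ N := by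
  have key : ∀ K : Subgroup G, K ≤ N ↔ K.map (QuotientGroup.mk' N) = ⊥ := by
    intro K
    rw [Subgroup.map_eq_bot_iff, QuotientGroup.ker_mk']
  rw [key, map_commutator, map_commutator] at h1 h2 ⊢
  exact commutator_commutator_eq_bot_of_rotate h1 h2

/-- Indices start at `0`, whence the `+ 1`. Induction on `j` through the three subgroups lemma. -/
theorem commutator_lowerCentralSeries_le {G : Type*} [Group G] (i j : ℕ) :
    ⁅(⊤ : Subgroup G).lowerCentralSeries i, (⊤ : Subgroup G).lowerCentralSeries j⁆ ≤
      (⊤ : Subgroup G).lowerCentralSeries (i + j + 1) := by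
  induction j generalizing i with
  | zero => exact le_rfl
  | succ j ih =>
    rw [commutator_comm, Subgroup.lowerCentralSeries_succ]
    refine commutator_commutator_le_of_rotate ?_ ?_
    · rw [commutator_comm (⊤ : Subgroup G), ← Subgroup.lowerCentralSeries_succ]
      refine (ih (i + 1)).trans (le_of_eq ?_)
      congr 1
      omega
    · refine (commutator_mono (ih i) le_rfl).trans ?_
      rw [← Subgroup.lowerCentralSeries_succ]
      exact le_of_eq (by congr 1)

/-! ### Filtered groups and polynomial maps on cubes. -/

/-- A descending series of subgroups, indexed from `0`, with `⁅F i, F j⁆ ≤ F (i + j)`. -/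
structure NSeries (G : Type*) [Group G] where
  toFun : ℕ → Subgroup G
  succ_le : ∀ i, toFun (i + 1) ≤ toFun i
  commutator_mem : ∀ i j, ∀ x ∈ toFun i, ∀ y ∈ toFun j, ⁅x, y⁆ ∈ toFun (i + j)

namespace NSeries

variable {G G' : Type*} [Group G] [Group G'] (F : NSeries G)

theorem antitone : Antitone F.toFun := antitone_nat_of_succ_le F.succ_le

theorem conj_mem {i : ℕ} {x y : G} (hx : x ∈ F.toFun 0) (hy : y ∈ F.toFun i) :
    x * y * x⁻¹ ∈ F.toFun i := by
  have h := F.commutator_mem 0 i x hx y hy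
  rw [Nat.zero_add] at h
  have := mul_mem h hy
  rwa [commutatorElement_def, inv_mul_cancel_right] at this

theorem conj_mem' {i : ℕ} {x y : G} (hx : x ∈ F.toFun 0) (hy : y ∈ F.toFun i) :
    x⁻¹ * y * x ∈ F.toFun i := by
  simpa using F.conj_mem (inv_mem hx) hy

/-- Commutators are well defined modulo the next degree. This is what makes `pairs` closed under
commutators with the right degrees. -/
theorem commutator_inv_mul_mem {i j : ℕ} {x y s t : G} (hx : x ∈ F.toFun i) (hy : y ∈ F.toFun j)
    (hs : s ∈ F.toFun (i + 1)) (ht : t ∈ F.toFun (j + 1)) :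
    ⁅x, y⁆⁻¹ * ⁅x * s, y * t⁆ ∈ F.toFun (i + j + 1) := by
  have h0 : ∀ {k z}, z ∈ F.toFun k → z ∈ F.toFun 0 := fun h => F.antitone (Nat.zero_le _) h
  have e : ⁅x, y⁆⁻¹ * ⁅x * s, y * t⁆ =
      (⁅x, y⁆⁻¹ * (x * ⁅s, y * t⁆ * x⁻¹) * ⁅x, y⁆) * (y * ⁅x, t⁆ * y⁻¹) := by
    simp only [commutatorElement_def]
    group
  rw [e]
  refine mul_mem (F.conj_mem' ?_ (F.conj_mem (h0 hx) ?_)) (F.conj_mem (h0 hy) ?_)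
  · exact h0 (F.commutator_mem i j x hx y hy)
  · have := F.commutator_mem (i + 1) j s hs (y * t) (mul_mem hy (F.succ_le _ ht))
    rwa [Nat.add_right_comm] at this
  · exact F.commutator_mem i (j + 1) x hx t ht

/-- The N-series of pairs, given by two homomorphisms `a` and `b`, which differ by an element
of the next term. -/
def pairs (a b : G' →* G) : NSeries G' where
  toFun j :=
    { carrier := {x | a x ∈ F.toFun j ∧ (a x)⁻¹ * b x ∈ F.toFun (j + 1)}
      one_mem' := by simp [one_mem]
      mul_mem' := by
        rintro x y ⟨hx, hx'⟩ ⟨hy, hy'⟩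
        refine ⟨by rw [map_mul]; exact mul_mem hx hy, ?_⟩
        have e : (a (x * y))⁻¹ * b (x * y) =
            ((a y)⁻¹ * ((a x)⁻¹ * b x) * a y) * ((a y)⁻¹ * b y) := by
          simp only [map_mul]; group
        rw [e]
        exact mul_mem (F.conj_mem' (F.antitone (Nat.zero_le _) hy) hx') hy'
      inv_mem' := by
        rintro x ⟨hx, hx'⟩
        refine ⟨by rw [map_inv]; exact inv_mem hx, ?_⟩
        have e : (a x⁻¹)⁻¹ * b x⁻¹ = a x * ((a x)⁻¹ * b x)⁻¹ * (a x)⁻¹ := by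
          simp only [map_inv]; group
        rw [e]
        exact F.conj_mem (F.antitone (Nat.zero_le _) hx) (inv_mem hx') }
  succ_le i x hx := ⟨F.succ_le _ hx.1, F.succ_le _ hx.2⟩
  commutator_mem := by
    rintro i j x ⟨hx, hx'⟩ y ⟨hy, hy'⟩
    refine ⟨by rw [map_commutatorElement]; exact F.commutator_mem i j _ hx _ hy, ?_⟩
    have := F.commutator_inv_mul_mem hx hy hx' hy'
    rwa [mul_inv_cancel_left, mul_inv_cancel_left, ← map_commutatorElement,
      ← map_commutatorElement] at this

/-- The pullback of an N-series. -/
def comap (a : G' →* G) : NSeries G' where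
  toFun j := (F.toFun j).comap a
  succ_le i := Subgroup.comap_mono (F.succ_le i)
  commutator_mem i j x hx y hy := by
    simp only [Subgroup.mem_comap, map_commutatorElement] at *
    exact F.commutator_mem i j _ hx _ hy

/-- The lower central series, with the whole group in degrees `0` and `1`. -/
def lower (G : Type*) [Group G] : NSeries G where
  -- Truncated subtraction puts the whole group in degree `0` as well as in degree `1`.
  toFun j := (⊤ : Subgroup G).lowerCentralSeries (j - 1)
  succ_le i := Subgroup.lowerCentralSeries_antitone _ (by omega)
  commutator_mem i j x hx y hy := by
    have hm : ∀ m (s t : G), s ∈ (⊤ : Subgroup G).lowerCentralSeries m →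
        ⁅s, t⁆ ∈ (⊤ : Subgroup G).lowerCentralSeries m ∧
        ⁅t, s⁆ ∈ (⊤ : Subgroup G).lowerCentralSeries m := fun m s t hs =>
      ⟨commutator_le_left _ ⊤ (commutator_mem_commutator hs (mem_top t)),
        commutator_le_right ⊤ _ (commutator_mem_commutator (mem_top t) hs)⟩
    rcases i with _ | i
    · have := (hm _ y x hy).2
      rwa [Nat.zero_add]
    rcases j with _ | j
    · exact (hm _ x y hx).1
    have := commutator_lowerCentralSeries_le i j (commutator_mem_commutator hx hy)
    have e : i + 1 + (j + 1) - 1 = i + j + 1 := by omega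
    rwa [e]

/-- The polynomial maps on the cube of subsets of the list `l`. -/
def cube : List ℕ → NSeries (Finset ℕ → G)
  | [] => F.comap (Pi.evalMonoidHom (fun _ => G) ∅)
  | i :: l => (cube l).pairs (MonoidHom.id _)
      { toFun := fun g w => g (insert i w)
        map_one' := rfl
        map_mul' := fun _ _ => rfl }

theorem mem_cube_cons {i : ℕ} {l : List ℕ} {j : ℕ} {g : Finset ℕ → G} :
    g ∈ (F.cube (i :: l)).toFun j ↔ g ∈ (F.cube l).toFun j ∧
      (fun w => (g w)⁻¹ * g (insert i w)) ∈ (F.cube l).toFun (j + 1) := Iff.rfl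

theorem mem_cube_of_eq_const {l : List ℕ} {j : ℕ} {g : Finset ℕ → G} {c : G}
    (hc : c ∈ F.toFun j) (hg : ∀ w : Finset ℕ, (∀ x ∈ w, x ∈ l) → g w = c) :
    g ∈ (F.cube l).toFun j := by
  induction l generalizing j g c with
  | nil =>
    change g ∅ ∈ F.toFun j
    rw [hg ∅ (by simp)]
    exact hc
  | cons i l ih =>
    rw [mem_cube_cons]
    refine ⟨ih hc fun w hw => hg w fun x hx => List.mem_cons_of_mem _ (hw x hx),
      ih (one_mem _) fun w hw => ?_⟩
    rw [hg w fun x hx => List.mem_cons_of_mem _ (hw x hx), hg (insert i w), inv_mul_cancel]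
    intro x hx
    rcases Finset.mem_insert.1 hx with rfl | hx
    · exact List.mem_cons_self
    · exact List.mem_cons_of_mem _ (hw x hx)

/-- These face elements generate the polynomial maps used below: a translation by a variable acts
where that variable is switched on and is trivial elsewhere. The jump from `1` to `c` across
direction `i` must have degree `1`. -/
theorem mem_cube_face {l : List ℕ} (hl : l.Nodup) {i : ℕ} {c : G} (hc : c ∈ F.toFun 1) :
    (fun w : Finset ℕ => if i ∈ w then c else 1) ∈ (F.cube l).toFun 0 := by
  induction l with
  | nil =>
    exact F.mem_cube_of_eq_const (one_mem _) fun w hw => if_neg fun h => by simpa using hw i h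
  | cons k l ih =>
    rw [List.nodup_cons] at hl
    rw [mem_cube_cons]
    refine ⟨ih hl.2, ?_⟩
    by_cases hki : k = i
    · subst hki
      refine F.mem_cube_of_eq_const hc fun w hw => ?_
      simp [show k ∉ w from fun h => hl.1 (hw k h)]
    · refine F.mem_cube_of_eq_const (one_mem _) fun w _ => ?_
      by_cases hi : i ∈ w <;> simp [Ne.symm hki, hi]

/-- If a polynomial map takes values in the subgroup `S` away from the top vertex of the cube, then
its value at the top vertex is in `S` up to an element of high degree. -/
theorem cube_top_mem (S : Subgroup G) {l : List ℕ} (hl : l.Nodup) {j : ℕ} {g : Finset ℕ → G}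
    (hg : g ∈ (F.cube l).toFun j)
    (hS : ∀ w : Finset ℕ, (∀ x ∈ w, x ∈ l) → (∃ x ∈ l, x ∉ w) → g w ∈ S) :
    ∃ s ∈ S, ∃ t ∈ F.toFun (j + l.length), g l.toFinset = s * t := by
  induction l generalizing j g with
  | nil => exact ⟨1, one_mem _, g ∅, hg, by simp⟩
  | cons i l ih =>
    rw [List.nodup_cons] at hl
    rw [mem_cube_cons] at hg
    have hi : ∀ w : Finset ℕ, (∀ x ∈ w, x ∈ l) → i ∉ w := fun w hw h => hl.1 (hw i h)
    have h1 : ∀ w : Finset ℕ, (∀ x ∈ w, x ∈ l) → g w ∈ S := fun w hw =>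
      hS w (fun x hx => List.mem_cons_of_mem _ (hw x hx)) ⟨i, List.mem_cons_self, hi w hw⟩
    -- The induction runs on the difference in direction `i`, whose degree is one higher; on the
    -- face without `i`, `g` lies wholly in `S`.
    obtain ⟨s, hs, t, ht, e⟩ := ih hl.2 hg.2 fun w hw ⟨x, hx, hxw⟩ => by
      refine mul_mem (inv_mem (h1 w hw)) (hS _ ?_ ⟨x, List.mem_cons_of_mem _ hx, ?_⟩)
      · intro y hy
        rcases Finset.mem_insert.1 hy with rfl | hy
        · exact List.mem_cons_self
        · exact List.mem_cons_of_mem _ (hw y hy)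
      · rw [Finset.mem_insert, not_or]
        exact ⟨fun h => hl.1 (h ▸ hx), hxw⟩
    refine ⟨g l.toFinset * s, mul_mem (h1 _ (by simp)) hs, t, ?_, ?_⟩
    · rwa [List.length_cons, ← Nat.add_assoc, Nat.add_right_comm]
    · rw [mul_assoc, ← e, mul_inv_cancel_left, List.toFinset_cons]

end NSeries

/-! ### The ascending chain condition in finitely generated nilpotent groups. -/

section Noetherian

/-- The ascending chain condition on subgroups passes to extensions. -/
theorem wellFoundedGT_subgroup_of_extension {G : Type*} [Group G] (N : Subgroup G) [N.Normal]
    [WellFoundedGT (Subgroup N)] [WellFoundedGT (Subgroup (G ⧸ N))] :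
    WellFoundedGT (Subgroup G) := by
  -- Nested subgroups with the same trace on `N` and the same image in the quotient are equal.
  let f : Subgroup G → Subgroup N × Subgroup (G ⧸ N) := fun H =>
    (H.subgroupOf N, H.map (QuotientGroup.mk' N))
  have hf : StrictMono f := by
    intro H K h
    refine lt_of_le_of_ne ⟨Subgroup.comap_mono h.le, Subgroup.map_mono h.le⟩ fun e => h.not_ge ?_
    intro x hx
    have e1 : H.subgroupOf N = K.subgroupOf N := congrArg Prod.fst e
    have e2 : H.map (QuotientGroup.mk' N) = K.map (QuotientGroup.mk' N) := congrArg Prod.snd e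
    have hx2 : QuotientGroup.mk' N x ∈ H.map (QuotientGroup.mk' N) := e2 ▸ ⟨x, hx, rfl⟩
    obtain ⟨y, hy, hyx⟩ := hx2
    have hn : y⁻¹ * x ∈ N := QuotientGroup.eq.1 hyx
    have hK : (⟨y⁻¹ * x, hn⟩ : N) ∈ H.subgroupOf N :=
      e1 ▸ (mul_mem (inv_mem (h.le hy)) hx : y⁻¹ * x ∈ K)
    have := mul_mem hy (show y⁻¹ * x ∈ H from hK)
    rwa [mul_inv_cancel_left] at this
  exact hf.wellFoundedGT

theorem wellFoundedGT_subgroup_of_comm {G : Type*} [CommGroup G] [Group.FG G] :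
    WellFoundedGT (Subgroup G) := by
  have : AddGroup.FG (Additive G) := inferInstance
  have : Module.Finite ℤ (Additive G) := Module.Finite.iff_addGroup_fg.2 inferInstance
  have : IsNoetherian ℤ (Additive G) := isNoetherian_of_isNoetherianRing_of_finite ℤ (Additive G)
  have h : WellFoundedGT (Submodule ℤ (Additive G)) := inferInstance
  exact ((Subgroup.toAddSubgroup (G := G)).trans
    (AddSubgroup.toIntSubmodule (M := Additive G))).strictMono.wellFoundedGT

/-- Under the ascending chain condition, every generating set of a subgroup contains a
finite one. -/
theorem exists_finset_closure_eq {G : Type*} [Group G] [WellFoundedGT (Subgroup G)] (S : Set G) :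
    ∃ U : Finset G, (U : Set G) ⊆ S ∧ closure (U : Set G) = closure S := by
  classical
  obtain ⟨_, ⟨U, hU, rfl⟩, hmax⟩ := wellFounded_gt.has_min
    {K : Subgroup G | ∃ U : Finset G, (U : Set G) ⊆ S ∧ closure (U : Set G) = K}
    ⟨_, ∅, by simp, rfl⟩
  refine ⟨U, hU, le_antisymm (closure_mono hU) ((closure_le _).2 fun x hx => ?_)⟩
  have hle : closure (U : Set G) ≤ closure ((insert x U : Finset G) : Set G) :=
    closure_mono (by simp)
  have := hmax (closure ((insert x U : Finset G) : Set G))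
    ⟨insert x U, by simpa [Set.insert_subset_iff] using ⟨hx, hU⟩, rfl⟩
  rw [eq_of_le_of_not_lt hle this]
  exact subset_closure (by simp)

/-- Since `N` is central, the commutator is multiplicative in each argument and does not see factors
from `N`. So `N` is generated by commutators of generators of `A` modulo `N` (finitely many, by the
chain condition in `G ⧸ N`) with generators of `G`. -/
theorem fg_central_commutator {G : Type*} [Group G] [Group.FG G] {A N : Subgroup G}
    (hN : N ≤ center G) (hAN : ⁅A, (⊤ : Subgroup G)⁆ = N) [N.Normal]
    [WellFoundedGT (Subgroup (G ⧸ N))] : N.FG := by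
  classical
  obtain ⟨T, hT⟩ := (Group.fg_def (G := G)).1 inferInstance
  obtain ⟨U, hU, hUA⟩ : ∃ U : Finset G, (∀ u ∈ U, u ∈ A) ∧ A ≤ closure (U : Set G) ⊔ N := by
    obtain ⟨U', hU', hc⟩ := exists_finset_closure_eq (QuotientGroup.mk' N '' (A : Set G))
    obtain ⟨U, hU, rfl⟩ := Finset.subset_set_image_iff.1 hU'
    refine ⟨U, hU, fun a ha => ?_⟩
    have h : QuotientGroup.mk' N a ∈ (closure (U : Set G)).map (QuotientGroup.mk' N) := by
      rw [MonoidHom.map_closure, ← Finset.coe_image, hc]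
      exact subset_closure ⟨a, ha, rfl⟩
    obtain ⟨b, hb, hba⟩ := h
    have := mul_mem_sup hb (QuotientGroup.eq.1 hba)
    rwa [mul_inv_cancel_left] at this
  have hcomm : ∀ a ∈ A, ∀ g h : G, h * ⁅a, g⁆ = ⁅a, g⁆ * h := fun a ha g =>
    mem_center_iff.1 (hN (hAN ▸ commutator_mem_commutator ha (mem_top g)))
  refine ⟨Finset.image₂ (fun a g => ⁅a, g⁆) U T, le_antisymm ?_ ?_⟩
  · rw [closure_le]
    intro x hx
    obtain ⟨a, ha, g, -, rfl⟩ := Finset.mem_image₂.1 (Finset.mem_coe.1 hx)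
    exact hAN ▸ commutator_mem_commutator (hU a ha) (mem_top g)
  · set K := closure ((Finset.image₂ (fun a g => ⁅a, g⁆) U T : Finset G) : Set G) with hK
    have h1 : ∀ a ∈ U, ∀ g : G, ⁅a, g⁆ ∈ K := by
      intro a ha g
      have hg : g ∈ closure (T : Set G) := hT ▸ mem_top g
      induction hg using closure_induction with
      | mem g hg =>
        exact subset_closure (Finset.mem_coe.2 (Finset.mem_image₂.2 ⟨a, ha, g, hg, rfl⟩))
      | one => simp [one_mem]
      | mul g h _ _ hg hh =>
        rw [commutatorElement_mul_right_eq_mul_conj, mul_assoc _ g, hcomm a (hU a ha) h g]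
        simpa [mul_assoc] using mul_mem hg hh
      | inv g _ hg =>
        have e : ⁅a, g⁻¹⁆ = g⁻¹ * ⁅a, g⁆⁻¹ * g := by simp only [commutatorElement_def]; group
        have e' : g⁻¹ * ⁅a, g⁆⁻¹ = ⁅a, g⁆⁻¹ * g⁻¹ := by
          rw [← mul_inv_rev, ← mul_inv_rev, hcomm a (hU a ha) g g]
        rw [e, e', inv_mul_cancel_right]
        exact inv_mem hg
    have h2 : ∀ a ∈ closure (U : Set G), ∀ g : G, ⁅a, g⁆ ∈ K := by
      intro a ha g
      have hA : ∀ b ∈ closure (U : Set G), b ∈ A := fun b hb => (closure_le A).2 hU hb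
      induction ha using closure_induction with
      | mem a ha => exact h1 a ha g
      | one => simp [one_mem]
      | mul a b ha hb iha ihb =>
        have e : ⁅a * b, g⁆ = a * ⁅b, g⁆ * a⁻¹ * ⁅a, g⁆ := by
          simp only [commutatorElement_def]; group
        rw [e, hcomm b (hA b hb), mul_inv_cancel_right]
        exact mul_mem ihb iha
      | inv a ha iha =>
        have e : ⁅a⁻¹, g⁆ = a⁻¹ * ⁅a, g⁆⁻¹ * a := by simp only [commutatorElement_def]; group
        have e' : a⁻¹ * ⁅a, g⁆⁻¹ = ⁅a, g⁆⁻¹ * a⁻¹ := by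
          rw [← mul_inv_rev, ← mul_inv_rev, hcomm a (hA a ha) g a]
        rw [e, e', inv_mul_cancel_right]
        exact inv_mem iha
    rw [← hAN, commutator_le]
    intro x hx g _
    obtain ⟨a, ha, z, hz, rfl⟩ := mem_sup_of_normal_right.1 (hUA hx)
    have hz' := mem_center_iff.1 (hN hz)
    have e : ⁅a * z, g⁆ = ⁅a, g⁆ := by
      simp only [commutatorElement_def, mul_inv_rev]
      rw [mul_assoc a z g, ← hz' g]
      group
    rw [e]
    exact h2 a ha g

/-- The last nontrivial term of the series is central and finitely generated, hence Noetherian as an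
abelian group; the quotient is handled by induction on the class. -/
theorem wellFoundedGT_subgroup_of_nilpotent (c : ℕ) {G : Type*} [Group G] [Group.FG G]
    (hc : (⊤ : Subgroup G).lowerCentralSeries c = ⊥) : WellFoundedGT (Subgroup G) := by
  induction c generalizing G with
  | zero =>
    have h : (⊤ : Subgroup G) = ⊥ := hc
    have : Subsingleton (Subgroup G) :=
      ⟨fun H K => (le_bot_iff.1 (h ▸ le_top)).trans (le_bot_iff.1 (h ▸ le_top)).symm⟩
    infer_instance
  | succ c ih =>
    let N := (⊤ : Subgroup G).lowerCentralSeries c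
    have : Group.FG (G ⧸ N) := QuotientGroup.fg N
    have : WellFoundedGT (Subgroup (G ⧸ N)) := by
      refine ih ?_
      have := Subgroup.map_lowerCentralSeries ⊤ (QuotientGroup.mk' N) c
      rw [Subgroup.map_top_of_surjective _ (QuotientGroup.mk'_surjective N)] at this
      rw [← this, Subgroup.map_eq_bot_iff, QuotientGroup.ker_mk']
    have hN : N ≤ center G := by
      rw [← commutator_top_right_eq_bot_iff_le_center]
      exact hc
    have hfg : N.FG := by
      rcases c with _ | c
      · exact (Group.fg_def (G := G)).1 inferInstance
      · exact fg_central_commutator hN rfl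
    have : Group.FG N := (Group.fg_iff_subgroup_fg N).2 hfg
    let _ : CommGroup N :=
      { mul_comm := fun a b => Subtype.ext (mem_center_iff.1 (hN b.2) a) }
    have : WellFoundedGT (Subgroup N) := wellFoundedGT_subgroup_of_comm
    exact wellFoundedGT_subgroup_of_extension N

end Noetherian

end GroupTheory
-- Loops, congruences, the centre, multiplication groups and central series.
section Loops

variable {E : Type u} [Loop E]

attribute [simp] Loop.mul_div_cancel Loop.div_mul_cancel Loop.ldiv_mul_cancel Loop.mul_ldiv_cancel
  Loop.one_mul Loop.mul_one

@[simp] theorem perm_apply_inv {α : Type*} (g : Equiv.Perm α) (x : α) : g (g⁻¹ x) = x :=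
  Equiv.apply_symm_apply g x

@[simp] theorem perm_inv_apply {α : Type*} (g : Equiv.Perm α) (x : α) : g⁻¹ (g x) = x :=
  Equiv.symm_apply_apply g x

namespace Loop

theorem mul_left_cancel {a b c : E} (h : a * b = a * c) : b = c := by
  rw [← Loop.ldiv_mul_cancel a b, h, Loop.ldiv_mul_cancel]

theorem mul_right_cancel {a b c : E} (h : b * a = c * a) : b = c := by
  rw [← Loop.mul_div_cancel b a, h, Loop.mul_div_cancel]

theorem ldiv_eq_iff {a b c : E} : Loop.ldiv a b = c ↔ b = a * c :=
  ⟨fun h => by rw [← h, Loop.mul_ldiv_cancel], fun h => by rw [h, Loop.ldiv_mul_cancel]⟩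

theorem div_eq_iff' {a b c : E} : a / b = c ↔ a = c * b :=
  ⟨fun h => by rw [← h, Loop.div_mul_cancel], fun h => by rw [h, Loop.mul_div_cancel]⟩

theorem ldiv_eq_one_iff {a b : E} : Loop.ldiv a b = 1 ↔ a = b := by
  rw [ldiv_eq_iff, Loop.mul_one, eq_comm]

@[simp] theorem ldiv_self (a : E) : Loop.ldiv a a = 1 := ldiv_eq_one_iff.2 rfl

@[simp] theorem one_ldiv (a : E) : Loop.ldiv 1 a = a := ldiv_eq_iff.2 (Loop.one_mul a).symm

@[simp] theorem div_self'' (a : E) : a / a = 1 := div_eq_iff'.2 (Loop.one_mul a).symm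

end Loop

@[simp] theorem leftTrans_apply (x y : E) : leftTrans x y = x * y := rfl
@[simp] theorem rightTrans_apply (x y : E) : rightTrans x y = y * x := rfl

theorem mul_innerT (x y : E) : x * innerT x y = y * x := Loop.mul_ldiv_cancel _ _

theorem innerR_mul (x y z : E) : innerR x y z * (x * y) = (z * x) * y := Loop.div_mul_cancel _ _

theorem mul_innerL (x y z : E) : (x * y) * innerL x y z = x * (y * z) := Loop.mul_ldiv_cancel _ _

/-- The inner mappings `T(x)`, `R(x, y)` and `L(x, y)` are multiplicative. -/
structure HasInnerAut (E : Type u) [Loop E] : Prop where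
  T : ∀ x a b : E, innerT x (a * b) = innerT x a * innerT x b
  R : ∀ x y a b : E, innerR x y (a * b) = innerR x y a * innerR x y b
  L : ∀ x y a b : E, innerL x y (a * b) = innerL x y a * innerL x y b

theorem IsALoop.hasInnerAut (h : IsALoop E) : HasInnerAut E where
  T x := h _ (Subgroup.subset_closure (Or.inl (Or.inl ⟨x, rfl⟩)))
  R x y := h _ (Subgroup.subset_closure (Or.inl (Or.inr ⟨x, y, rfl⟩)))
  L x y := h _ (Subgroup.subset_closure (Or.inr ⟨x, y, rfl⟩))

/-- A map between loops which preserves products. -/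
def IsLoopHom {E' : Type v} [Loop E'] (f : E → E') : Prop := ∀ x y, f (x * y) = f x * f y

namespace IsLoopHom

variable {E' : Type v} [Loop E'] {f : E → E'} (hf : IsLoopHom f)
include hf

theorem map_one : f 1 = 1 := by
  have := hf 1 1
  rw [Loop.mul_one] at this
  exact (Loop.mul_left_cancel (this.symm.trans (Loop.mul_one _).symm))

theorem map_ldiv (x y : E) : f (Loop.ldiv x y) = Loop.ldiv (f x) (f y) := by
  rw [eq_comm, Loop.ldiv_eq_iff, ← hf, Loop.mul_ldiv_cancel]

theorem map_div (x y : E) : f (x / y) = f x / f y := by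
  rw [eq_comm, Loop.div_eq_iff', ← hf, Loop.div_mul_cancel]

end IsLoopHom

/-- The set `S` generates the loop. -/
def Generates (S : Set E) : Prop := ∀ K : Set E, IsSubloop K → S ⊆ K → ∀ x, x ∈ K

theorem IsSubloop.preimage {E' : Type v} [Loop E'] {f : E → E'} (hf : IsLoopHom f) {K : Set E'}
    (hK : IsSubloop K) : IsSubloop (f ⁻¹' K) where
  one_mem := by simpa [hf.map_one] using hK.one_mem
  mul_mem x hx y hy := by simpa [hf x y] using hK.mul_mem _ hx _ hy
  ldiv_mem x hx y hy := by simpa [hf.map_ldiv] using hK.ldiv_mem _ hx _ hy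
  div_mem x hx y hy := by simpa [hf.map_div] using hK.div_mem _ hx _ hy

theorem Generates.image {E' : Type v} [Loop E'] {f : E → E'} (hf : IsLoopHom f)
    (hs : Function.Surjective f) {S : Set E} (hS : Generates S) : Generates (f '' S) := by
  intro K hK hSK y
  obtain ⟨x, rfl⟩ := hs y
  exact hS _ (hK.preimage hf) (Set.image_subset_iff.1 hSK) x

/-- A congruence of a loop. -/
structure LoopCon (E : Type u) [Loop E] where
  ofData ::
  r : E → E → Prop
  iseqv : Equivalence r
  mul : ∀ {a b c d}, r a b → r c d → r (a * c) (b * d)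
  ldiv : ∀ {a b c d}, r a b → r c d → r (Loop.ldiv a c) (Loop.ldiv b d)
  div : ∀ {a b c d}, r a b → r c d → r (a / c) (b / d)

namespace LoopCon

variable (θ : LoopCon E)

theorem refl (a : E) : θ.r a a := θ.iseqv.refl a
theorem symm {a b : E} (h : θ.r a b) : θ.r b a := θ.iseqv.symm h
theorem trans {a b c : E} (h : θ.r a b) (h' : θ.r b c) : θ.r a c := θ.iseqv.trans h h'

/-- A congruence from an equivalence relation compatible with multiplication and cancellation. -/
def ofCancel (r : E → E → Prop) (iseqv : Equivalence r)
    (left : ∀ x a b, r (x * a) (x * b) ↔ r a b) (right : ∀ x a b, r (a * x) (b * x) ↔ r a b) :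
    LoopCon E where
  r := r
  iseqv := iseqv
  mul {a b c d} h h' := iseqv.trans ((right c a b).2 h) ((left b c d).2 h')
  ldiv {a b c d} h h' := by
    rw [← left b, Loop.mul_ldiv_cancel]
    refine iseqv.trans ((right _ b a).2 (iseqv.symm h)) ?_
    rwa [Loop.mul_ldiv_cancel]
  div {a b c d} h h' := by
    rw [← right d, Loop.div_mul_cancel]
    refine iseqv.trans ((left _ d c).2 (iseqv.symm h')) ?_
    rwa [Loop.div_mul_cancel]

/-- The quotient loop. -/
def Quotient : Type u := Quot θ.r

/-- The canonical projection. -/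
def mk (a : E) : θ.Quotient := Quot.mk θ.r a

theorem mk_eq {a b : E} : θ.mk a = θ.mk b ↔ θ.r a b :=
  ⟨fun h => θ.iseqv.eqvGen_iff.1 (Quot.eqvGen_exact h), fun h => Quot.sound h⟩

theorem mk_surjective : Function.Surjective θ.mk := Quot.exists_rep

instance : Loop θ.Quotient where
  mul := Quot.map₂ (· * ·) (fun _ _ _ h => θ.mul (θ.refl _) h) (fun _ _ _ h => θ.mul h (θ.refl _))
  one := θ.mk 1
  div := Quot.map₂ (· / ·) (fun _ _ _ h => θ.div (θ.refl _) h) (fun _ _ _ h => θ.div h (θ.refl _))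
  ldiv := Quot.map₂ Loop.ldiv (fun _ _ _ h => θ.ldiv (θ.refl _) h)
    (fun _ _ _ h => θ.ldiv h (θ.refl _))
  mul_div_cancel := by rintro ⟨x⟩ ⟨y⟩; exact congrArg θ.mk (Loop.mul_div_cancel x y)
  div_mul_cancel := by rintro ⟨x⟩ ⟨y⟩; exact congrArg θ.mk (Loop.div_mul_cancel x y)
  ldiv_mul_cancel := by rintro ⟨x⟩ ⟨y⟩; exact congrArg θ.mk (Loop.ldiv_mul_cancel x y)
  mul_ldiv_cancel := by rintro ⟨x⟩ ⟨y⟩; exact congrArg θ.mk (Loop.mul_ldiv_cancel x y)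
  one_mul := by rintro ⟨x⟩; exact congrArg θ.mk (Loop.one_mul x)
  mul_one := by rintro ⟨x⟩; exact congrArg θ.mk (Loop.mul_one x)

theorem mk_hom : IsLoopHom θ.mk := fun _ _ => rfl
theorem mk_mul (a b : E) : θ.mk (a * b) = θ.mk a * θ.mk b := rfl
theorem mk_one : θ.mk 1 = 1 := rfl

theorem r_one_iff {a : E} : θ.r a 1 ↔ θ.mk a = 1 := θ.mk_eq.symm

/-- The image of a congruence in a quotient. -/
def push (ψ : LoopCon E) (h : ∀ {a b}, θ.r a b → ψ.r a b) : LoopCon θ.Quotient where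
  r := Quot.lift₂ ψ.r
    (fun _ _ _ hb => propext ⟨fun e => ψ.trans e (h hb), fun e => ψ.trans e (ψ.symm (h hb))⟩)
    (fun _ _ _ ha => propext ⟨fun e => ψ.trans (ψ.symm (h ha)) e, fun e => ψ.trans (h ha) e⟩)
  iseqv :=
    ⟨by rintro ⟨a⟩; exact ψ.refl a, by rintro ⟨a⟩ ⟨b⟩ h; exact ψ.symm h,
      by rintro ⟨a⟩ ⟨b⟩ ⟨c⟩ h h'; exact ψ.trans h h'⟩
  mul := by rintro ⟨a⟩ ⟨b⟩ ⟨c⟩ ⟨d⟩ h h'; exact ψ.mul h h'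
  ldiv := by rintro ⟨a⟩ ⟨b⟩ ⟨c⟩ ⟨d⟩ h h'; exact ψ.ldiv h h'
  div := by rintro ⟨a⟩ ⟨b⟩ ⟨c⟩ ⟨d⟩ h h'; exact ψ.div h h'

/-- The pullback of a congruence along a homomorphism. -/
def comap {E' : Type v} [Loop E'] (ψ : LoopCon E') (f : E → E') (hf : IsLoopHom f) :
    LoopCon E where
  r a b := ψ.r (f a) (f b)
  iseqv := ⟨fun _ => ψ.refl _, fun h => ψ.symm h, fun h h' => ψ.trans h h'⟩
  mul h h' := by rw [hf, hf]; exact ψ.mul h h'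
  ldiv h h' := by rw [hf.map_ldiv, hf.map_ldiv]; exact ψ.ldiv h h'
  div h h' := by rw [hf.map_div, hf.map_div]; exact ψ.div h h'

/-- The intersection of a set of congruences. -/
def inf (S : Set (LoopCon E)) : LoopCon E where
  r a b := ∀ θ ∈ S, θ.r a b
  iseqv := ⟨fun a θ _ => θ.refl a, fun h θ hθ => θ.symm (h θ hθ),
    fun h h' θ hθ => θ.trans (h θ hθ) (h' θ hθ)⟩
  mul h h' θ hθ := θ.mul (h θ hθ) (h' θ hθ)
  ldiv h h' θ hθ := θ.ldiv (h θ hθ) (h' θ hθ)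
  div h h' θ hθ := θ.div (h θ hθ) (h' θ hθ)

/-- The total congruence. -/
def total (E : Type u) [Loop E] : LoopCon E where
  r _ _ := True
  iseqv := ⟨fun _ => trivial, fun _ => trivial, fun _ _ => trivial⟩
  mul _ _ := trivial
  ldiv _ _ := trivial
  div _ _ := trivial

/-- Equality. -/
def eq (E : Type u) [Loop E] : LoopCon E where
  r a b := a = b
  iseqv := eq_equivalence
  mul := by rintro _ _ _ _ rfl rfl; rfl
  ldiv := by rintro _ _ _ _ rfl rfl; rfl
  div := by rintro _ _ _ _ rfl rfl; rfl

end LoopCon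

theorem HasInnerAut.of_surjective {E' : Type v} [Loop E'] {f : E → E'} (hf : IsLoopHom f)
    (hs : Function.Surjective f) (h : HasInnerAut E) : HasInnerAut E' := by
  have hT : ∀ x a, f (innerT x a) = innerT (f x) (f a) := fun x a =>
    Loop.mul_left_cancel (by rw [mul_innerT, ← hf, mul_innerT, hf])
  have hR : ∀ x y a, f (innerR x y a) = innerR (f x) (f y) (f a) := fun x y a =>
    Loop.mul_right_cancel (a := f x * f y) (by rw [innerR_mul, ← hf, ← hf, innerR_mul, hf, hf])
  have hL : ∀ x y a, f (innerL x y a) = innerL (f x) (f y) (f a) := fun x y a =>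
    Loop.mul_left_cancel (a := f x * f y) (by rw [mul_innerL, ← hf, ← hf, mul_innerL, hf, hf])
  constructor
  · intro x a b
    obtain ⟨x, rfl⟩ := hs x
    obtain ⟨a, rfl⟩ := hs a
    obtain ⟨b, rfl⟩ := hs b
    rw [← hf, ← hT, ← hT, ← hT, ← hf, h.T]
  · intro x y a b
    obtain ⟨x, rfl⟩ := hs x
    obtain ⟨y, rfl⟩ := hs y
    obtain ⟨a, rfl⟩ := hs a
    obtain ⟨b, rfl⟩ := hs b
    rw [← hf, ← hR, ← hR, ← hR, ← hf, h.R]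
  · intro x y a b
    obtain ⟨x, rfl⟩ := hs x
    obtain ⟨y, rfl⟩ := hs y
    obtain ⟨a, rfl⟩ := hs a
    obtain ⟨b, rfl⟩ := hs b
    rw [← hf, ← hL, ← hL, ← hL, ← hf, h.L]

theorem IsMoufang.of_surjective {E' : Type v} [Loop E'] {f : E → E'} (hf : IsLoopHom f)
    (hs : Function.Surjective f) (h : IsMoufang E) : IsMoufang E' := by
  intro x y z
  obtain ⟨x, rfl⟩ := hs x
  obtain ⟨y, rfl⟩ := hs y
  obtain ⟨z, rfl⟩ := hs z
  rw [← hf, ← hf, ← hf, ← hf, ← hf, ← hf, h]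

/-- Central elements: they commute and associate with all elements. -/
structure IsCentral (z : E) : Prop where
  comm : ∀ x, z * x = x * z
  left : ∀ x y, (z * x) * y = z * (x * y)
  swap : ∀ x y, x * (z * y) = z * (x * y)

namespace IsCentral

theorem one : IsCentral (1 : E) := ⟨by simp, by simp, by simp⟩

theorem mul {z w : E} (hz : IsCentral z) (hw : IsCentral w) : IsCentral (z * w) where
  comm x := by rw [hz.left, hw.comm, hz.swap]
  left x y := by rw [hz.left, hz.left, hw.left, hz.left]
  swap x y := by rw [hz.left, hz.swap, hw.swap, hz.left]

theorem mul_ldiv_one_mul {z : E} (hz : IsCentral z) (x : E) : z * (Loop.ldiv z 1 * x) = x := by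
  rw [← hz.left, Loop.mul_ldiv_cancel, Loop.one_mul]

theorem ldiv_one {z : E} (hz : IsCentral z) : IsCentral (Loop.ldiv z 1) where
  comm x := Loop.mul_left_cancel (a := z) (by
    rw [hz.mul_ldiv_one_mul, ← hz.swap, Loop.mul_ldiv_cancel, Loop.mul_one])
  left x y := Loop.mul_left_cancel (a := z) (by
    rw [hz.mul_ldiv_one_mul, ← hz.left, hz.mul_ldiv_one_mul])
  swap x y := Loop.mul_left_cancel (a := z) (by
    rw [hz.mul_ldiv_one_mul, ← hz.swap, hz.mul_ldiv_one_mul])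

end IsCentral

variable (E) in

/-- The centre, as an abelian group. -/
def Center : Type u := {z : E // IsCentral z}

instance : CommGroup (Center E) where
  mul z w := ⟨z.1 * w.1, z.2.mul w.2⟩
  one := ⟨1, IsCentral.one⟩
  inv z := ⟨Loop.ldiv z.1 1, z.2.ldiv_one⟩
  mul_assoc z w t := Subtype.ext (z.2.left _ _)
  one_mul z := Subtype.ext (Loop.one_mul _)
  mul_one z := Subtype.ext (Loop.mul_one _)
  mul_comm z w := Subtype.ext (z.2.comm _)
  inv_mul_cancel z := Subtype.ext ((z.2.comm _).symm.trans (Loop.mul_ldiv_cancel _ _))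

instance : MulAction (Center E) E where
  smul z x := z.1 * x
  one_smul := Loop.one_mul
  mul_smul z _ _ := z.2.left _ _

/-- A central element, as an element of the centre. -/
def IsCentral.toCenter {z : E} (hz : IsCentral z) : Center E := ⟨z, hz⟩

theorem IsCentral.toCenter_smul {z : E} (hz : IsCentral z) (x : E) : hz.toCenter • x = z * x := rfl

namespace Center

theorem smul_def (z : Center E) (x : E) : z • x = z.1 * x := rfl

@[simp] theorem smul_mul (z : Center E) (x y : E) : (z • x) * y = z • (x * y) := z.2.left _ _

@[simp] theorem mul_smul' (z : Center E) (x y : E) : x * (z • y) = z • (x * y) := z.2.swap _ _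

@[simp] theorem smul_right_inj (z w : Center E) (x : E) : z • x = w • x ↔ z = w :=
  ⟨fun h => Subtype.ext (Loop.mul_right_cancel h), fun h => h ▸ rfl⟩

/-- A homomorphism to the centre takes values in a subgroup if it does so on generators. -/
theorem mem_of_generates {f : E → Center E} (hf : ∀ x y, f (x * y) = f x * f y)
    (A : Subgroup (Center E)) {S : Set E} (hS : Generates S) (h : ∀ x ∈ S, f x ∈ A) (x : E) :
    f x ∈ A := by
  have h1 : f 1 = 1 := by
    have := hf 1 1
    rwa [Loop.mul_one, left_eq_mul] at this
  refine hS {x | f x ∈ A} ⟨?_, ?_, ?_, ?_⟩ h x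
  · simp [h1, one_mem]
  · intro x hx y hy
    simpa [hf] using mul_mem hx hy
  · intro x hx y hy
    have := hf x (Loop.ldiv x y)
    rw [Loop.mul_ldiv_cancel] at this
    rw [Set.mem_ofPred_eq, ← inv_mul_cancel_left (f x) (f (Loop.ldiv x y)), ← this]
    exact mul_mem (inv_mem hx) hy
  · intro x hx y hy
    have := hf (x / y) y
    rw [Loop.div_mul_cancel] at this
    rw [Set.mem_ofPred_eq, ← mul_inv_cancel_right (f (x / y)) (f y), ← this]
    exact mul_mem hx (inv_mem hy)

end Center

/-- The congruence given by a subgroup of the centre. -/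
def LoopCon.ofCenter (A : Subgroup (Center E)) : LoopCon E :=
  LoopCon.ofCancel (fun x y => ∃ z ∈ A, y = z • x)
    ⟨fun x => ⟨1, one_mem A, by simp⟩,
      fun {x y} ⟨z, hz, h⟩ => ⟨z⁻¹, inv_mem hz, by rw [h, inv_smul_smul]⟩,
      fun {x y t} ⟨z, hz, h⟩ ⟨w, hw, h'⟩ => ⟨w * z, mul_mem hw hz, by rw [h', h, mul_smul]⟩⟩
    (fun x a b => ⟨fun ⟨z, hz, h⟩ => ⟨z, hz, Loop.mul_left_cancel (h.trans (by simp))⟩,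
      fun ⟨z, hz, h⟩ => ⟨z, hz, by simp [h]⟩⟩)
    (fun x a b => ⟨fun ⟨z, hz, h⟩ => ⟨z, hz, Loop.mul_right_cancel (h.trans (by simp))⟩,
      fun ⟨z, hz, h⟩ => ⟨z, hz, by simp [h]⟩⟩)

/-- The group of permutations generated by the translations by elements of `S`. -/
def mltOf (S : Set E) : Subgroup (Equiv.Perm E) :=
  Subgroup.closure (leftTrans '' S ∪ rightTrans '' S)

theorem leftTrans_mem_mltOf {S : Set E} {e : E} (he : e ∈ S) : leftTrans e ∈ mltOf S :=
  Subgroup.subset_closure (Or.inl ⟨e, he, rfl⟩)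

theorem rightTrans_mem_mltOf {S : Set E} {e : E} (he : e ∈ S) : rightTrans e ∈ mltOf S :=
  Subgroup.subset_closure (Or.inr ⟨e, he, rfl⟩)

theorem mltOf_induction {S : Set E} {p : ∀ g : Equiv.Perm E, g ∈ mltOf S → Prop}
    (left : ∀ e (he : e ∈ S), p (leftTrans e) (leftTrans_mem_mltOf he))
    (right : ∀ e (he : e ∈ S), p (rightTrans e) (rightTrans_mem_mltOf he))
    (one : p 1 (one_mem _))
    (mul : ∀ g h hg hh, p g hg → p h hh → p (g * h) (mul_mem hg hh))
    (inv : ∀ g hg, p g hg → p g⁻¹ (inv_mem hg)) {g : Equiv.Perm E}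
    (hg : g ∈ mltOf S) : p g hg := by
  induction hg using Subgroup.closure_induction with
  | mem x hx =>
    rcases hx with ⟨e, he, rfl⟩ | ⟨e, he, rfl⟩
    exacts [left e he, right e he]
  | one => exact one
  | mul x y _ _ hx hy => exact mul x y _ _ hx hy
  | inv x _ hx => exact inv x _ hx

theorem mltOf_smul {S : Set E} {g : Equiv.Perm E} (hg : g ∈ mltOf S) (z : Center E) (x : E) :
    g (z • x) = z • g x := by
  induction hg using mltOf_induction generalizing x with
  | left e he => simp
  | right e he => simp
  | one => rfl
  | mul g h _ _ hg hh => rw [Equiv.Perm.mul_apply, hh, hg, Equiv.Perm.mul_apply]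
  | inv g _ hg => rw [Equiv.Perm.inv_eq_iff_eq, hg, perm_apply_inv]

section Hom

variable {E' : Type v} [Loop E'] {f : E → E'} (hf : IsLoopHom f)
include hf

theorem exists_mltOf_image {S : Set E} {g : Equiv.Perm E} (hg : g ∈ mltOf S) :
    ∃ g' ∈ mltOf (f '' S), ∀ x, f (g x) = g' (f x) := by
  induction hg using mltOf_induction with
  | left e he => exact ⟨_, leftTrans_mem_mltOf ⟨e, he, rfl⟩, fun x => hf _ _⟩
  | right e he => exact ⟨_, rightTrans_mem_mltOf ⟨e, he, rfl⟩, fun x => hf _ _⟩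
  | one => exact ⟨1, one_mem _, fun x => rfl⟩
  | mul g h _ _ hg hh =>
    obtain ⟨g', hg', eg⟩ := hg
    obtain ⟨h', hh', eh⟩ := hh
    exact ⟨g' * h', mul_mem hg' hh', fun x => by
      rw [Equiv.Perm.mul_apply, eg, eh, Equiv.Perm.mul_apply]⟩
  | inv g _ hg =>
    obtain ⟨g', hg', eg⟩ := hg
    exact ⟨g'⁻¹, inv_mem hg', fun x => by
      rw [Equiv.Perm.eq_inv_iff_eq, ← eg, perm_apply_inv]⟩

theorem exists_mltOf_lift {S : Set E} {g : Equiv.Perm E'} (hg : g ∈ mltOf (f '' S)) :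
    ∃ g' ∈ mltOf S, ∀ x, f (g' x) = g (f x) := by
  induction hg using mltOf_induction with
  | left e he =>
    obtain ⟨e, he, rfl⟩ := he
    exact ⟨_, leftTrans_mem_mltOf he, fun x => hf _ _⟩
  | right e he =>
    obtain ⟨e, he, rfl⟩ := he
    exact ⟨_, rightTrans_mem_mltOf he, fun x => hf _ _⟩
  | one => exact ⟨1, one_mem _, fun x => rfl⟩
  | mul g h _ _ hg hh =>
    obtain ⟨g', hg', eg⟩ := hg
    obtain ⟨h', hh', eh⟩ := hh
    exact ⟨g' * h', mul_mem hg' hh', fun x => by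
      rw [Equiv.Perm.mul_apply, eg, eh, Equiv.Perm.mul_apply]⟩
  | inv g _ hg =>
    obtain ⟨g', hg', eg⟩ := hg
    exact ⟨g'⁻¹, inv_mem hg', fun x => by
      rw [Equiv.Perm.eq_inv_iff_eq, ← eg, perm_apply_inv]⟩

end Hom

theorem mltOf_smul_mk {S : Set E} {g : Equiv.Perm E} (hg : g ∈ mltOf S) (θ : LoopCon E)
    {z : Center θ.Quotient} {x y : E} (h : θ.mk y = z • θ.mk x) : θ.mk (g y) = z • θ.mk (g x) := by
  obtain ⟨g', hg', e⟩ := exists_mltOf_image θ.mk_hom hg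
  rw [e, e, h, mltOf_smul hg']

theorem mltOf_mk {S : Set E} {g : Equiv.Perm E} (hg : g ∈ mltOf S) (θ : LoopCon E)
    {x y : E} (h : θ.r y x) : θ.r (g y) (g x) := by
  rw [← θ.mk_eq] at h ⊢
  obtain ⟨g', hg', e⟩ := exists_mltOf_image θ.mk_hom hg
  rw [e, e, h]

section NormalSubloop

variable {K : Set E} (hK : IsNormalSubloop K)
include hK

theorem IsNormalSubloop.congrMod_iff {a b : E} :
    CongrMod K a b ↔ (fun h => a * h) '' K = (fun h => b * h) '' K := by
  constructor
  · intro h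
    obtain ⟨k, hk, rfl⟩ : ∃ k ∈ K, b = a * k := ⟨_, h, (Loop.mul_ldiv_cancel a b).symm⟩
    rw [← hK.left a k]
    ext x
    constructor
    · rintro ⟨l, hl, rfl⟩
      exact ⟨Loop.ldiv k l, hK.ldiv_mem _ hk _ hl, by simp⟩
    · rintro ⟨l, hl, rfl⟩
      exact ⟨k * l, hK.mul_mem _ hk _ hl, rfl⟩
  · intro h
    have : b ∈ (fun h => a * h) '' K := h ▸ ⟨1, hK.one_mem, Loop.mul_one b⟩
    obtain ⟨k, hk, rfl⟩ := this
    simpa [CongrMod] using hk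

omit hK in
theorem congrMod_iff_mem {a b : E} :
    CongrMod K a b ↔ b ∈ (fun h => a * h) '' K :=
  ⟨fun h => ⟨_, h, Loop.mul_ldiv_cancel a b⟩, by
    rintro ⟨k, hk, rfl⟩
    simpa [CongrMod] using hk⟩

/-- The congruence modulo a normal subloop. -/
def IsNormalSubloop.con : LoopCon E :=
  LoopCon.ofCancel (CongrMod K)
    ⟨fun a => hK.congrMod_iff.2 rfl, fun h => hK.congrMod_iff.2 (hK.congrMod_iff.1 h).symm,
      fun h h' => hK.congrMod_iff.2 ((hK.congrMod_iff.1 h).trans (hK.congrMod_iff.1 h'))⟩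
    (fun x a b => by
      rw [congrMod_iff_mem, congrMod_iff_mem, ← hK.left]
      exact ⟨fun ⟨k, hk, e⟩ => ⟨k, hk, Loop.mul_left_cancel e⟩,
        fun ⟨k, hk, e⟩ => ⟨k, hk, congrArg (x * ·) e⟩⟩)
    (fun x a b => by
      rw [congrMod_iff_mem, congrMod_iff_mem, hK.comm, hK.comm, hK.right]
      exact ⟨fun ⟨k, hk, e⟩ => ⟨k, hk, Loop.mul_right_cancel e⟩,
        fun ⟨k, hk, e⟩ => ⟨k, hk, congrArg (· * x) e⟩⟩)

theorem IsNormalSubloop.con_mk_eq_one {a : E} : hK.con.mk a = 1 ↔ a ∈ K := by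
  rw [eq_comm, ← LoopCon.mk_one, LoopCon.mk_eq]
  change Loop.ldiv 1 a ∈ K ↔ a ∈ K
  rw [Loop.one_ldiv]

theorem CentralMod.isCentral_mk {a : E} (ha : CentralMod K a) : IsCentral (hK.con.mk a) := by
  have hc : ∀ x, hK.con.mk a * x = x * hK.con.mk a := by
    intro x
    obtain ⟨x, rfl⟩ := hK.con.mk_surjective x
    exact hK.con.mk_eq.2 (ha x 1).1
  have hl : ∀ x y, (hK.con.mk a * x) * y = hK.con.mk a * (x * y) := by
    intro x y
    obtain ⟨x, rfl⟩ := hK.con.mk_surjective x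
    obtain ⟨y, rfl⟩ := hK.con.mk_surjective y
    exact hK.con.mk_eq.2 (ha x y).2.1
  refine ⟨hc, hl, fun x y => ?_⟩
  rw [← hl, hc x]
  obtain ⟨x, rfl⟩ := hK.con.mk_surjective x
  obtain ⟨y, rfl⟩ := hK.con.mk_surjective y
  exact (hK.con.mk_eq.2 (ha x y).2.2.1).symm

end NormalSubloop

/-- A finite descending series of congruences with central factors. -/
structure IsCentralSeries (θ : ℕ → LoopCon E) (n : ℕ) : Prop where
  top : ∀ x y, (θ 0).r x y
  bot : ∀ x y, (θ n).r x y → x = y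
  central : ∀ i < n, ∀ x, (θ i).r x 1 → IsCentral ((θ (i + 1)).mk x)

variable (E) in

/-- The upper central series. -/
def upperCon : ℕ → LoopCon E
  | 0 => LoopCon.eq E
  | k + 1 => (LoopCon.ofCenter ⊤).comap (upperCon k).mk (upperCon k).mk_hom

theorem upperCon_succ_r_one {k : ℕ} {x : E} :
    (upperCon E (k + 1)).r x 1 ↔ IsCentral ((upperCon E k).mk x) := by
  change (∃ z ∈ (⊤ : Subgroup (Center (upperCon E k).Quotient)), _ = _) ↔ _
  constructor
  · rintro ⟨z, -, h⟩
    have : (upperCon E k).mk x = z⁻¹ • (1 : (upperCon E k).Quotient) := by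
      rw [← LoopCon.mk_one, h, inv_smul_smul]
    rw [this, Center.smul_def, Loop.mul_one]
    exact z⁻¹.2
  · intro h
    refine ⟨h.toCenter⁻¹, trivial, ?_⟩
    rw [eq_inv_smul_iff, LoopCon.mk_one, h.toCenter_smul, Loop.mul_one]

theorem isCentralSeries_upperCon {n : ℕ} (h : ∀ x, (upperCon E n).r x 1) :
    IsCentralSeries (fun i => upperCon E (n - i)) n where
  top x y := (upperCon E n).trans (h x) ((upperCon E n).symm (h y))
  bot x y hxy := by
    rw [Nat.sub_self] at hxy
    exact hxy
  central i hi x hx := by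
    have e : n - i = n - (i + 1) + 1 := by omega
    rw [e] at hx
    exact upperCon_succ_r_one.1 hx

end Loops

/-! ### Nilpotency of groups acting on a centrally nilpotent loop. -/

section Nilpotent

open scoped commutatorElement

variable {E : Type u} [Loop E]

/-- A central-valued function with `c (x * y) * c 1 = c x * c y` is changed by multiplication maps
only by a constant factor. -/
theorem exists_mul_of_affine {A : Type*} [CommGroup A] {c : E → A}
    (hc : ∀ x y, c (x * y) * c 1 = c x * c y) {S : Set E} {g : Equiv.Perm E} (hg : g ∈ mltOf S) :
    ∃ d : A, ∀ x, c (g x) = d * c x := by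
  induction hg using mltOf_induction with
  | left e he =>
    refine ⟨c e * (c 1)⁻¹, fun x => ?_⟩
    rw [leftTrans_apply, eq_mul_inv_of_mul_eq (hc e x), mul_right_comm]
  | right e he =>
    refine ⟨c e * (c 1)⁻¹, fun x => ?_⟩
    rw [rightTrans_apply, eq_mul_inv_of_mul_eq (hc x e), mul_comm (c x), mul_right_comm]
  | one => exact ⟨1, fun x => (one_mul _).symm⟩
  | mul g h _ _ hg hh =>
    obtain ⟨d, hd⟩ := hg
    obtain ⟨d', hd'⟩ := hh
    exact ⟨d * d', fun x => by rw [Equiv.Perm.mul_apply, hd, hd', mul_assoc]⟩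
  | inv g _ hg =>
    obtain ⟨d, hd⟩ := hg
    exact ⟨d⁻¹, fun x => by rw [eq_inv_mul_iff_mul_eq, ← hd, perm_apply_inv]⟩

theorem IsCentralSeries.exists_smul {θ : ℕ → LoopCon E} {n : ℕ} (hθ : IsCentralSeries θ n) {i : ℕ}
    (hi : i < n) {x y : E} (h : (θ i).r y x) :
    ∃ z : Center (θ (i + 1)).Quotient, (θ (i + 1)).mk y = z • (θ (i + 1)).mk x := by
  have h1 : (θ i).r (y / x) 1 := by
    have := (θ i).div h ((θ i).refl x)
    rwa [Loop.div_self''] at this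
  refine ⟨(hθ.central i hi _ h1).toCenter, ?_⟩
  rw [IsCentral.toCenter_smul, ← LoopCon.mk_mul, Loop.div_mul_cancel]

/-- A group acting through multiplication maps on a centrally nilpotent loop of class `n` has
nilpotency class at most `2 * n`, if the elements trivial modulo a term of a central series act
by affine maps modulo the next term. -/
theorem lowerCentralSeries_eq_bot_of_affine {Γ ι : Type*} [Group Γ] (ρ : ι → Γ →* Equiv.Perm E)
    (hρ : ∀ k g, ρ k g ∈ mltOf (Set.univ : Set E)) (hinj : ∀ g, (∀ k, ρ k g = 1) → g = 1)
    {θ : ℕ → LoopCon E} {n : ℕ} (hθ : IsCentralSeries θ n)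
    (haff : ∀ i < n, ∀ g, ∀ c : ι → E → Center (θ (i + 1)).Quotient,
      (∀ k x, (θ (i + 1)).mk (ρ k g x) = c k x • (θ (i + 1)).mk x) →
      ∀ k x y, c k (x * y) * c k 1 = c k x * c k y) :
    (⊤ : Subgroup Γ).lowerCentralSeries (2 * n) = ⊥ := by
  have hstep : ∀ i < n, ∀ g : Γ, (∀ k x, (θ i).r (ρ k g x) x) → ∀ (V W : Γ) (k : ι) (x : E),
      (θ (i + 1)).r (ρ k ⁅⁅g, V⁆, W⁆ x) x := by
    intro i hi g hg V W k x
    choose c hc using fun k x => hθ.exists_smul hi (hg k x)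
    have ha := haff i hi g c hc k
    -- Affinity makes `c` change under `V` only by a constant `d`, so the commutator with `V`
    -- multiplies by the single central element `d`.
    have key : ∃ d : Center (θ (i + 1)).Quotient, ∀ x,
        (θ (i + 1)).mk (ρ k ⁅g, V⁆ x) = d • (θ (i + 1)).mk x := by
      obtain ⟨d, hd⟩ := exists_mul_of_affine ha (hρ k V)
      refine ⟨d, fun y => ?_⟩
      set x := (ρ k g)⁻¹ ((ρ k V)⁻¹ y)
      have e : ρ k ⁅g, V⁆ y = ρ k g (ρ k V x) := by
        simp [commutatorElement_def, x, Equiv.Perm.mul_apply]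
      have e' : y = ρ k V (ρ k g x) := by simp [x]
      rw [e, hc, hd, mul_smul, ← mltOf_smul_mk (hρ k V) _ (hc k x), ← e']
    obtain ⟨d, hd⟩ := key
    set G := ρ k ⁅g, V⁆
    set w := G⁻¹ ((ρ k W)⁻¹ x)
    have e : ρ k ⁅⁅g, V⁆, W⁆ x = G (ρ k W w) := by
      rw [commutatorElement_def ⁅g, V⁆ W, map_mul, map_mul, map_mul, map_inv, map_inv]
      rfl
    -- Multiplication by a central constant commutes with `W`, so the second commutator is trivial
    -- modulo the next term.
    have e' : x = ρ k W (G w) := by simp [w]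
    rw [← LoopCon.mk_eq, e, hd, ← mltOf_smul_mk (hρ k W) _ (hd w), ← e']
  have hmem : ∀ i ≤ n, ∀ g ∈ (⊤ : Subgroup Γ).lowerCentralSeries (2 * i), ∀ k x,
      (θ i).r (ρ k g x) x := by
    intro i
    induction i with
    | zero => exact fun _ g _ k x => hθ.top _ _
    | succ i ih =>
      intro hi
      let C : Subgroup Γ :=
        { carrier := {g | ∀ k x, (θ (i + 1)).r (ρ k g x) x}
          one_mem' := fun k x => by rw [map_one]; exact LoopCon.refl _ _
          mul_mem' := fun {g h} hg hh k x => by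
            rw [map_mul]; exact LoopCon.trans _ (hg k _) (hh k x)
          inv_mem' := fun {g} hg k x => by
            have := hg k ((ρ k g)⁻¹ x)
            rw [perm_apply_inv] at this
            rw [map_inv]
            exact LoopCon.symm _ this }
      have hCn : ∀ g ∈ C, ∀ h, h * g * h⁻¹ ∈ C := by
        intro g hg h k x
        have := mltOf_mk (hρ k h) _ (hg k ((ρ k h)⁻¹ x))
        rw [perm_apply_inv] at this
        simpa using this
      have : C.Normal := ⟨hCn⟩
      have h1 : ∀ g ∈ (⊤ : Subgroup Γ).lowerCentralSeries (2 * i), ∀ V,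
          ∀ W, ⁅⁅g, V⁆, W⁆ ∈ C := fun g hg V W =>
        hstep i hi g (ih (by omega) g hg) V W
      suffices h : (⊤ : Subgroup Γ).lowerCentralSeries (2 * (i + 1)) ≤ C from fun g hg => h hg
      have e : 2 * (i + 1) = 2 * i + 1 + 1 := by ring
      rw [e, Subgroup.lowerCentralSeries_succ]
      -- `hstep` only controls double commutators of elements; passing through the centre of `Γ ⧸ C`
      -- extends this to the subgroups they generate.
      let D : Subgroup Γ := (Subgroup.center (Γ ⧸ C)).comap (QuotientGroup.mk' C)
      have hD : ⁅(⊤ : Subgroup Γ).lowerCentralSeries (2 * i), (⊤ : Subgroup Γ)⁆ ≤ D := by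
        rw [Subgroup.commutator_le]
        intro g hg V _
        rw [Subgroup.mem_comap, Subgroup.mem_center_iff]
        intro W
        obtain ⟨W, rfl⟩ := QuotientGroup.mk'_surjective C W
        have := h1 g hg V W
        rw [eq_comm, ← commutatorElement_eq_one_iff_mul_comm, ← map_commutatorElement]
        exact (QuotientGroup.eq_one_iff _).2 this
      rw [Subgroup.commutator_le]
      intro g hg W _
      have := Subgroup.mem_center_iff.1 (Subgroup.mem_comap.1 (hD hg)) (QuotientGroup.mk' C W)
      rw [eq_comm, ← commutatorElement_eq_one_iff_mul_comm, ← map_commutatorElement] at this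
      exact (QuotientGroup.eq_one_iff _).1 this
  rw [eq_bot_iff]
  intro g hg
  exact hinj g fun k => Equiv.ext fun x => hθ.bot _ _ (hmem n le_rfl g hg k x)

end Nilpotent

/-! ### A-loops: the multiplication group is nilpotent. -/

section ALoop

variable {E : Type u} [Loop E]

variable (E) in

/-- The automorphism group, as a group of permutations. -/
def autPerm : Subgroup (Equiv.Perm E) where
  carrier := {g | ∀ x y, g (x * y) = g x * g y}
  one_mem' _ _ := rfl
  mul_mem' {g h} hg hh x y := by
    rw [Equiv.Perm.mul_apply, hh, hg]
    rfl
  inv_mem' {g} hg x y := by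
    rw [Equiv.Perm.inv_eq_iff_eq, hg, perm_apply_inv, perm_apply_inv]

theorem autPerm_conj_leftTrans {φ : Equiv.Perm E} (hφ : φ ∈ autPerm E) (u : E) :
    φ * leftTrans u = leftTrans (φ u) * φ :=
  Equiv.ext fun x => hφ u x

variable (h : HasInnerAut E)
include h

/-- Products of left translations are again left translations up to the automorphism `innerL`, right
translations are so up to `innerT`, and automorphisms can be moved to the right past left
translations. -/
theorem HasInnerAut.exists_leftTrans_mul {S : Set E} {g : Equiv.Perm E} (hg : g ∈ mltOf S) :
    ∃ u, ∃ φ ∈ autPerm E, g = leftTrans u * φ := by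
  have hL : ∀ x y : E, leftTrans x * leftTrans y = leftTrans (x * y) * innerL x y := fun x y => by
    rw [innerL, mul_assoc, mul_inv_cancel_left]
  induction hg using mltOf_induction with
  | left e he => exact ⟨e, 1, one_mem _, (mul_one _).symm⟩
  | right e he => exact ⟨e, innerT e, h.T e, by simp [innerT]⟩
  | one => exact ⟨1, 1, one_mem _, Equiv.ext fun x => (Loop.one_mul x).symm⟩
  | mul g g' _ _ hg hg' =>
    obtain ⟨u, φ, hφ, rfl⟩ := hg
    obtain ⟨v, ψ, hψ, rfl⟩ := hg'
    refine ⟨u * φ v, innerL u (φ v) * φ * ψ, mul_mem (mul_mem (h.L _ _) hφ) hψ, ?_⟩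
    rw [mul_assoc, ← mul_assoc φ, autPerm_conj_leftTrans hφ, ← mul_assoc, ← mul_assoc, hL]
    simp only [mul_assoc]
  | inv g _ hg =>
    obtain ⟨u, φ, hφ, rfl⟩ := hg
    set v := Loop.ldiv u 1
    have hv : (leftTrans u)⁻¹ = leftTrans v * (innerL u v)⁻¹ := by
      have h1 : leftTrans (1 : E) = 1 := Equiv.ext fun x => Loop.one_mul x
      have := hL u v
      rw [show u * v = 1 from Loop.mul_ldiv_cancel _ _, h1, one_mul] at this
      rw [← this]
      group
    refine ⟨φ⁻¹ v, φ⁻¹ * (innerL u v)⁻¹, mul_mem (inv_mem hφ) (inv_mem (h.L _ _)), ?_⟩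
    rw [mul_inv_rev, hv, ← mul_assoc, autPerm_conj_leftTrans (inv_mem hφ), mul_assoc]

theorem HasInnerAut.exists_apply_eq {S : Set E} {g : Equiv.Perm E} (hg : g ∈ mltOf S) :
    ∃ φ ∈ autPerm E, ∀ x, g x = g 1 * φ x := by
  obtain ⟨u, φ, hφ, rfl⟩ := h.exists_leftTrans_mul hg
  refine ⟨φ, hφ, fun x => ?_⟩
  have h1 : φ 1 = 1 := IsLoopHom.map_one hφ
  simp [h1]

/-- The multiplication group of a nilpotent A-loop of class `n` is nilpotent of class at
most `2 * n`. -/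
theorem HasInnerAut.mlt_nilpotent {θ : ℕ → LoopCon E} {n : ℕ} (hθ : IsCentralSeries θ n) :
    (⊤ : Subgroup (mltOf (Set.univ : Set E))).lowerCentralSeries (2 * n) = ⊥ := by
  refine lowerCentralSeries_eq_bot_of_affine (ι := Unit)
    (fun _ => (mltOf (Set.univ : Set E)).subtype) (fun _ g => g.2)
    (fun g hg => Subtype.ext (hg ())) hθ ?_
  intro i hi g c hc k x y
  obtain ⟨φ, hφ, e⟩ := h.exists_apply_eq g.2
  set π := (θ (i + 1)).mk
  have hπ : IsLoopHom π := LoopCon.mk_hom _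
  have h1 : π (g.1 1) = c k 1 • (1 : (θ (i + 1)).Quotient) := by
    rw [← hπ.map_one]; exact hc k 1
  -- After normalizing at `1`, the factor of `g` is that of an automorphism, hence multiplicative;
  -- this is the affinity of `c`.
  have hφ' : ∀ x, π (φ x) = ((c k 1)⁻¹ * c k x) • π x := by
    intro x
    have e1 : c k x • π x = c k 1 • π (φ x) := by
      rw [← hc k x]
      change π (g.1 x) = _
      rw [e, hπ, h1, Center.smul_mul, Loop.one_mul]
    rw [mul_smul, e1, inv_smul_smul]
  have := congrArg π (hφ x y)
  rw [hπ, hφ', hφ', hφ', hπ, Center.smul_mul, Center.mul_smul', ← mul_smul,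
    Center.smul_right_inj] at this
  calc c k (x * y) * c k 1 = ((c k 1)⁻¹ * c k (x * y)) * (c k 1 * c k 1) := by
        rw [mul_mul_mul_comm, inv_mul_cancel, one_mul]
    _ = _ := by
        rw [this, mul_mul_mul_comm, inv_mul_cancel_comm, inv_mul_cancel_comm]

end ALoop

/-! ### A-loops: translations by generators act transitively. -/

section ALoopTransitive

variable {E : Type u} [Loop E]

theorem innerR_smul (x y : E) (z : Center E) (a : E) : innerR x y (z • a) = z • innerR x y a :=
  Loop.mul_right_cancel (a := x * y) (by
    rw [innerR_mul, Center.smul_mul, Center.smul_mul, Center.smul_mul, innerR_mul])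

/-- The subgroup of the centre of those elements whose translation belongs to `mltOf S`. -/
def centerOf (S : Set E) : Subgroup (Center E) :=
  (mltOf S).comap (MulAction.toPermHom (Center E) E)

theorem mem_centerOf {S : Set E} {g g' : Equiv.Perm E} (hg : g ∈ mltOf S) (hg' : g' ∈ mltOf S)
    {z : Center E} (h : ∀ x, g x = z • g' x) : z ∈ centerOf S := by
  have : MulAction.toPermHom (Center E) E z = g * g'⁻¹ := Equiv.ext fun x => by
    rw [Equiv.Perm.mul_apply, h, perm_apply_inv]
    rfl
  rw [centerOf, Subgroup.mem_comap, this]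
  exact mul_mem hg (inv_mem hg')

section LeftNuclear

variable (hE : HasInnerAut E) {q : E} {h : E → Center E} (h1 : ∀ x, q * x = h x • (x * q))
  (h2 : ∀ x y, (q * x) * y = q * (x * y))
include hE h1

/-- `innerT q` is the automorphism that multiplies `x` by `(h x)⁻¹`. -/
theorem comm_factor_mul (x y : E) : h (x * y) = h x * h y := by
  have hT : ∀ x, innerT q x = (h x)⁻¹ • x := fun x => Loop.mul_left_cancel (a := q) (by
    rw [mul_innerT, Center.mul_smul', h1, inv_smul_smul])
  have := hE.T q x y
  rw [hT, hT, hT, Center.smul_mul, Center.mul_smul', ← mul_smul, Center.smul_right_inj,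
    ← mul_inv] at this
  exact inv_injective this

include h2

/-- `innerT x` is an automorphism and multiplies `q` by `h x`; applying it to a product `q * w`
moves `x` past `q`. -/
theorem mul_leftNuclear_mul (x z : E) : q * (x * z) = h x • (x * (q * z)) := by
  have e : innerT x q = h x • q := Loop.mul_left_cancel (a := x) (by
    rw [mul_innerT, Center.mul_smul', h1])
  obtain ⟨w, rfl⟩ : ∃ w, z = innerT x w := ⟨(innerT x)⁻¹ z, by simp⟩
  have := congrArg (x * ·) (hE.T x q w)
  rw [mul_innerT, h2, e, Center.smul_mul, Center.mul_smul'] at this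
  rw [mul_innerT, this]

theorem mul_mul_leftNuclear (x y : E) : x * (y * q) = (x * y) * q := by
  have e : ∀ y, y * q = (h y)⁻¹ • (q * y) := fun y => by rw [h1, inv_smul_smul]
  rw [e, e, Center.mul_smul', mul_leftNuclear_mul hE h1 h2, comm_factor_mul hE h1, ← mul_smul,
    mul_inv, mul_comm (h x)⁻¹, inv_mul_cancel_right]

theorem mul_leftNuclear_mul' (x y : E) : (x * q) * y = h y • ((x * y) * q) := by
  have e : ∀ y, y * q = (h y)⁻¹ • (q * y) := fun y => by rw [h1, inv_smul_smul]
  rw [e, e, Center.smul_mul, h2, ← mul_smul, comm_factor_mul hE h1]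
  congr 1
  rw [mul_inv, mul_comm (h x)⁻¹, mul_inv_cancel_left]

end LeftNuclear

theorem HasInnerAut.isCentral (hE : HasInnerAut E) {c : E} (h1 : ∀ x, c * x = x * c)
    (h2 : ∀ x y, (c * x) * y = c * (x * y)) : IsCentral c where
  comm := h1
  left := h2
  swap x y := by
    have := mul_leftNuclear_mul hE (h := fun _ => 1) (by simpa using h1) h2 x y
    rwa [one_smul, eq_comm] at this

/-- A map `k` from the multiplication group which is the left translation by `q` up to central
factors: then the central factors in the commutation of `q` are in `centerOf S`. -/
theorem comm_factor_mem (hE : HasInnerAut E) {S : Set E} (hS : Generates S) {q : E}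
    {h : E → Center E} (h1 : ∀ x, q * x = h x • (x * q)) (h2 : ∀ x y, (q * x) * y = q * (x * y))
    {k : Equiv.Perm E} (hk : k ∈ mltOf S) {c : E → Center E} (hc : ∀ x, k x = c x • (q * x))
    (x : E) : h x ∈ centerOf S := by
  -- As `q` associates on the left, the automorphism part of `k` is multiplication by `(c 1)⁻¹ * c
  -- x`.
  have ha : ∀ x y, c (x * y) * c 1 = c x * c y := by
    obtain ⟨φ, hφ, e⟩ := hE.exists_apply_eq hk
    have hφ' : ∀ x, φ x = ((c 1)⁻¹ * c x) • x := fun x => by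
      have := (e x).symm.trans (hc x)
      rw [hc 1, Loop.mul_one, Center.smul_mul, ← Center.mul_smul', ← Center.mul_smul'] at this
      rw [mul_smul, eq_inv_smul_iff]
      exact Loop.mul_left_cancel this
    intro x y
    have := hφ x y
    rw [hφ', hφ', hφ', Center.smul_mul, Center.mul_smul', ← mul_smul, Center.smul_right_inj] at this
    calc c (x * y) * c 1 = ((c 1)⁻¹ * c (x * y)) * (c 1 * c 1) := by
          rw [mul_mul_mul_comm, inv_mul_cancel, one_mul]
      _ = _ := by rw [this, mul_mul_mul_comm, inv_mul_cancel_comm, inv_mul_cancel_comm]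
  refine Center.mem_of_generates (comm_factor_mul hE h1) _ hS (fun e he => ?_) x
  -- Comparing `k` with the left and with the right translation by `e` gives two central elements of
  -- the group; their quotient is `h e`.
  have m1 : c e * (c 1)⁻¹ * h e ∈ centerOf S := by
    refine mem_centerOf (mul_mem hk (leftTrans_mem_mltOf he))
      (mul_mem (leftTrans_mem_mltOf he) hk) fun x => ?_
    simp only [Equiv.Perm.mul_apply, leftTrans_apply]
    rw [hc, hc, mul_leftNuclear_mul hE h1 h2, Center.mul_smul', ← mul_smul, ← mul_smul,
      eq_mul_inv_of_mul_eq (ha e x)]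
    congr 1
    simp only [mul_assoc, mul_comm, mul_left_comm]
  have m2 : c e * (c 1)⁻¹ ∈ centerOf S := by
    refine mem_centerOf (mul_mem hk (rightTrans_mem_mltOf he))
      (mul_mem (rightTrans_mem_mltOf he) hk) fun x => ?_
    simp only [Equiv.Perm.mul_apply, rightTrans_apply]
    rw [hc, hc, Center.smul_mul, h2, ← mul_smul, eq_mul_inv_of_mul_eq (ha x e)]
    congr 1
    simp only [mul_assoc, mul_comm, mul_left_comm]
  exact (Subgroup.mul_mem_cancel_left _ m2).1 m1

section AssocFactor

variable (hE : HasInnerAut E) {p : E} {f : E → E → Center E}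
  (hf : ∀ x y, (p * x) * y = f x y • (p * (x * y)))
include hE hf

/-- `innerL p b` is the automorphism that multiplies `x` by `(f b x)⁻¹`. -/
theorem assoc_factor_mul_right (b x y : E) : f b (x * y) = f b x * f b y := by
  have hL : ∀ x, innerL p b x = (f b x)⁻¹ • x := fun x => Loop.mul_left_cancel (a := p * b) (by
    rw [mul_innerL, Center.mul_smul', hf, inv_smul_smul])
  have := hE.L p b x y
  rw [hL, hL, hL, Center.smul_mul, Center.mul_smul', ← mul_smul, Center.smul_right_inj,
    ← mul_inv] at this
  exact inv_injective this

/-- `innerR c d` multiplies `p` by `f c d` and leaves the values of `f` unchanged. Expand `((p * b)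
* c) * d` once by reassociating step by step, once through this automorphism. -/
theorem assoc_factor_mul_left (b c d : E) : f (b * c) d = f b d * f c d := by
  have hR : innerR c d p = f c d • p := Loop.mul_right_cancel (a := c * d) (by
    rw [innerR_mul, Center.smul_mul, hf])
  have hr : ∀ b x, f b (innerR c d x) = f b x := fun b x => by
    have := congrArg (f b) (innerR_mul c d x)
    simp only [assoc_factor_mul_right hE hf] at this
    rw [mul_assoc] at this
    exact mul_right_cancel this
  have hl : ∀ x, f (innerR c d b) x = f b x := fun x => by
    have := congrArg (innerR c d) (hf b x)
    rw [innerR_smul, hE.R, hE.R, hE.R, hE.R, hR, Center.smul_mul, Center.smul_mul,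
      Center.smul_mul, hf, ← mul_smul, ← mul_smul, Center.smul_right_inj, hr, mul_comm] at this
    exact mul_right_cancel this
  have e1 : ((p * b) * c) * d = (f b c * f (b * c) d) • (p * ((b * c) * d)) := by
    rw [hf, Center.smul_mul, hf, mul_smul]
  rw [← innerR_mul, hE.R, hR, Center.smul_mul, Center.smul_mul, hf, innerR_mul, ← mul_smul,
    Center.smul_right_inj, hl, assoc_factor_mul_right hE hf] at e1
  have : f b c * f (b * c) d = f b c * (f b d * f c d) := by
    rw [← e1, mul_comm, mul_assoc]
  exact mul_left_cancel this

end AssocFactor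

/-- If translations by elements of the class of `β` are induced, up to central factors, by
`mltOf S`, then the central factors arising in commutators and associators are in `centerOf S`. -/
theorem assoc_factor_mem (hE : HasInnerAut E) {S : Set E} (hS : Generates S) (β : LoopCon E)
    (hβ1 : ∀ q, β.r q 1 → ∀ x, ∃ z ∈ centerOf S, q * x = z • (x * q))
    (hβ2 : ∀ q, β.r q 1 → ∀ x y, (q * x) * y = q * (x * y))
    {p : E} {f : E → E → Center E} (hf : ∀ x y, (p * x) * y = f x y • (p * (x * y)))
    {k : Equiv.Perm E} (hk : k ∈ mltOf S) (hkp : ∀ x, β.r (k x) (p * x)) (x y : E) :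
    f x y ∈ centerOf S := by
  have hb : β.r (Loop.ldiv p (k 1)) 1 := by
    have := β.ldiv (β.refl p) (hkp 1)
    rwa [Loop.mul_one, Loop.ldiv_self] at this
  obtain ⟨P, hP⟩ : ∃ P, P = k 1 := ⟨_, rfl⟩
  -- `P` differs from `p` by a factor `b` that associates on the left, so both have the same
  -- associator factors; `k` is then `P` times an automorphism `φ`.
  have hfP : ∀ x y, (P * x) * y = f x y • (P * (x * y)) := by
    intro x y
    set b := Loop.ldiv p (k 1)
    have e : P = p * b := by rw [hP, Loop.mul_ldiv_cancel]
    have e1 : innerR x y b = b := Loop.mul_right_cancel (a := x * y) (by rw [innerR_mul, hβ2 b hb])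
    have e2 : innerR x y p = f x y • p := Loop.mul_right_cancel (a := x * y) (by
      rw [innerR_mul, hf, Center.smul_mul])
    rw [e, ← innerR_mul, hE.R, e1, e2, Center.smul_mul, Center.smul_mul]
  have hPp : β.r P p := by simpa [hP] using hkp 1
  obtain ⟨φ, hφ, hkφ⟩ := hE.exists_apply_eq hk
  rw [← hP] at hkφ
  have hφβ : ∀ x, β.r (φ x) x := fun x => by
    have := β.ldiv hPp (hkp x)
    rwa [hkφ, Loop.ldiv_mul_cancel, Loop.ldiv_mul_cancel] at this
  have h1 := assoc_factor_mul_left hE hfP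
  have h2 := assoc_factor_mul_right hE hfP
  have key : ∀ e ∈ S, ∀ e' ∈ S, f e' e ∈ centerOf S := by
    intro e he e' he'
    have ha : β.r (Loop.ldiv e (φ e)) 1 := by
      have := β.ldiv (β.refl e) (hφβ e)
      rwa [Loop.ldiv_self] at this
    set a := Loop.ldiv e (φ e)
    have hea : φ e = e * a := (Loop.mul_ldiv_cancel _ _).symm
    choose h hh hha using hβ1 a ha
    have hfa : ∀ x, f x a = 1 := fun x => by
      have := hfP x a
      rw [mul_mul_leftNuclear hE hha (hβ2 a ha)] at this
      rw [← Center.smul_right_inj _ _ (P * x * a), one_smul, ← this]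
    -- The commutator of `k` with the right translation by `e` is right multiplication by `a`, up to
    -- a central factor that involves `f x e`.
    set v : Equiv.Perm E := k * rightTrans e * (rightTrans e * k)⁻¹ with hv
    have hvm : v ∈ mltOf S := mul_mem (mul_mem hk (rightTrans_mem_mltOf he))
      (inv_mem (mul_mem (rightTrans_mem_mltOf he) hk))
    obtain ⟨κ, hκ⟩ : ∃ κ : Center E, ∀ x, v x = (κ * (f x e)⁻¹) • (x * a) := by
      refine ⟨f P e * f e e, fun X => ?_⟩
      obtain ⟨x, rfl⟩ : ∃ x, X = k x * e :=
        ⟨(rightTrans e * k)⁻¹ X, by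
          change X = (rightTrans e * k) _
          rw [perm_apply_inv]⟩
      have e0 : v (k x * e) = k (x * e) := by
        change (k * rightTrans e * (rightTrans e * k)⁻¹) ((rightTrans e * k) x) = _
        rw [Equiv.Perm.mul_apply, perm_inv_apply]
        rfl
      have e1 : f (φ x) (φ e) = f (φ x) e := by rw [hea, h2, hfa, mul_one]
      have e2 : k (x * e) = (f (φ x) e)⁻¹ • (k x * φ e) := by
        rw [hkφ, hφ x e, hkφ x, hfP, e1, inv_smul_smul]
      have e3 : f (k x * e) e = f P e * f (φ x) e * f e e := by rw [h1, hkφ, h1]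
      rw [e0, e2, hea, mul_mul_leftNuclear hE hha (hβ2 a ha), e3, mul_inv, mul_inv]
      congr 1
      rw [mul_mul_mul_comm, mul_inv_cancel, mul_one, mul_inv_cancel_left]
    -- A second commutation, with the right translation by `e'`, isolates `f e' e` up to the factor
    -- `h e'`, which is already known to be in `centerOf S`.
    have hm : (h e')⁻¹ * (f e' e)⁻¹ ∈ centerOf S := by
      refine mem_centerOf (mul_mem hvm (rightTrans_mem_mltOf he'))
        (mul_mem (rightTrans_mem_mltOf he') hvm) fun x => ?_
      simp only [Equiv.Perm.mul_apply, rightTrans_apply]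
      rw [hκ, hκ, Center.smul_mul, mul_leftNuclear_mul' hE hha (hβ2 a ha), h1, ← mul_smul,
        ← mul_smul, mul_inv]
      congr 1
      calc κ * ((f x e)⁻¹ * (f e' e)⁻¹) = (h e')⁻¹ * h e' * (κ * ((f x e)⁻¹ * (f e' e)⁻¹)) := by
            rw [inv_mul_cancel, one_mul]
        _ = _ := by simp only [mul_assoc, mul_comm, mul_left_comm]
    rw [← mul_inv, inv_mem_iff] at hm
    exact (Subgroup.mul_mem_cancel_left _ (hh e')).1 hm
  refine Center.mem_of_generates (fun y y' => h2 x y y') _ hS (fun e he => ?_) y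
  exact Center.mem_of_generates (fun x x' => h1 x x' e) _ hS (fun e' he' => key e he e' he') x

variable (E) in

/-- A descending series of congruences: modulo term `j + 2`, the elements of term `j + 1` commute
with everything, and those of term `j` associate on the left. -/
def commAssocCon : ℕ → LoopCon E
  | 0 => LoopCon.total E
  | 1 => LoopCon.total E
  | j + 2 => LoopCon.inf {θ | (∀ q, (commAssocCon (j + 1)).r q 1 → ∀ x, θ.r (q * x) (x * q)) ∧
      ∀ p, (commAssocCon j).r p 1 → ∀ x y, θ.r ((p * x) * y) (p * (x * y))}

theorem commAssocCon_comm {j : ℕ} {q : E} (hq : (commAssocCon E (j + 1)).r q 1) (x : E) :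
    (commAssocCon E (j + 2)).r (q * x) (x * q) := fun _ hθ => hθ.1 q hq x

theorem commAssocCon_assoc {j : ℕ} {p : E} (hp : (commAssocCon E j).r p 1) (x y : E) :
    (commAssocCon E (j + 2)).r ((p * x) * y) (p * (x * y)) := fun _ hθ => hθ.2 p hp x y

theorem commAssocCon_antitone (j : ℕ) {a b : E} (h : (commAssocCon E (j + 1)).r a b) :
    (commAssocCon E j).r a b := by
  induction j using Nat.strong_induction_on generalizing a b with
  | _ j ih =>
    match j, ih, h with
    | 0, _, _ => trivial
    | 1, _, _ => trivial
    | j + 2, ih, h =>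
      exact fun θ hθ => h θ ⟨fun q hq => hθ.1 q (ih (j + 1) (by omega) hq),
        fun p hp => hθ.2 p (ih j (by omega) hp)⟩

/-- Two steps of this series cost one central step: if term `2 * i` lies below `θ i`, its elements
are central modulo `θ (i + 1)`, so `θ (i + 1)` is among the congruences intersected to form term `2
* i + 2`. -/
theorem IsCentralSeries.commAssocCon_le {θ : ℕ → LoopCon E} {n : ℕ} (hθ : IsCentralSeries θ n)
    {i : ℕ} (hi : i ≤ n) {a b : E} (h : (commAssocCon E (2 * i)).r a b) : (θ i).r a b := by
  induction i generalizing a b with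
  | zero => exact hθ.top a b
  | succ i ih =>
    have hc : ∀ q, (commAssocCon E (2 * i)).r q 1 → IsCentral ((θ (i + 1)).mk q) := fun q hq =>
      hθ.central i hi q (ih (by omega) hq)
    refine h _ ⟨fun q hq x => ?_, fun p hp x y => ?_⟩
    · exact (LoopCon.mk_eq _).1 ((hc q (commAssocCon_antitone _ hq)).comm (LoopCon.mk _ x))
    · exact (LoopCon.mk_eq _).1 ((hc p hp).left (LoopCon.mk _ x) (LoopCon.mk _ y))

/-- Translations by the elements of each term of the series are induced by `mltOf S` modulo the
next term. -/
theorem exists_mltOf_commAssocCon (hE : HasInnerAut E) {S : Set E} (hS : Generates S) (j : ℕ)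
    {w : E} (hw : (commAssocCon E j).r w 1) :
    ∃ k ∈ mltOf S, ∀ x, (commAssocCon E (j + 1)).r (k x) (w * x) := by
  induction j using Nat.strong_induction_on generalizing w with
  | _ j ih =>
    match j, ih, hw with
    | 0, _, _ => exact ⟨1, one_mem _, fun _ => trivial⟩
    | 1, _, _ =>
      -- Modulo term `2` the loop is an abelian group, so the elements whose translations are
      -- induced form a subloop containing `S`.
      have ha : ∀ a b c, (commAssocCon E 2).mk ((a * b) * c) = (commAssocCon E 2).mk (a * (b * c)) :=
        fun a b c => (LoopCon.mk_eq _).2 (commAssocCon_assoc (j := 0) trivial b c)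
      have hcm : ∀ a b, (commAssocCon E 2).mk (a * b) = (commAssocCon E 2).mk (b * a) :=
        fun a b => (LoopCon.mk_eq _).2 (commAssocCon_comm (j := 0) trivial b)
      simp only [← LoopCon.mk_eq]
      refine hS {w | ∃ k ∈ mltOf S, ∀ x, (commAssocCon E 2).mk (k x) =
        (commAssocCon E 2).mk (w * x)} ⟨?_, ?_, ?_, ?_⟩ ?_ w
      · exact ⟨1, one_mem _, fun x => by simp⟩
      · rintro a ⟨k, hk, e⟩ b ⟨k', hk', e'⟩
        refine ⟨k * k', mul_mem hk hk', fun x => ?_⟩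
        rw [Equiv.Perm.mul_apply, e, LoopCon.mk_mul, e', ← LoopCon.mk_mul, ← ha]
      · rintro a ⟨k, hk, e⟩ b ⟨k', hk', e'⟩
        refine ⟨k⁻¹ * k', mul_mem (inv_mem hk) hk', fun x => ?_⟩
        refine Loop.mul_left_cancel (a := (commAssocCon E 2).mk a) ?_
        rw [← LoopCon.mk_mul, ← e, Equiv.Perm.mul_apply, perm_apply_inv, e', ← LoopCon.mk_mul,
          ← ha, Loop.mul_ldiv_cancel]
      · rintro a ⟨k, hk, e⟩ b ⟨k', hk', e'⟩
        refine ⟨k'⁻¹ * k, mul_mem (inv_mem hk') hk, fun x => ?_⟩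
        refine Loop.mul_left_cancel (a := (commAssocCon E 2).mk b) ?_
        rw [← LoopCon.mk_mul, ← e', Equiv.Perm.mul_apply, perm_apply_inv, e, ← LoopCon.mk_mul,
          ← ha, LoopCon.mk_mul _ (b * (a / b)), hcm b, Loop.div_mul_cancel, LoopCon.mk_mul]
      · exact fun e he => ⟨_, leftTrans_mem_mltOf he, fun _ => rfl⟩
    | j + 2, ih, hw =>
      let μ := commAssocCon E (j + 3)
      have hπ : IsLoopHom μ.mk := μ.mk_hom
      have hE' : HasInnerAut μ.Quotient := hE.of_surjective hπ μ.mk_surjective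
      let S' := μ.mk '' S
      have hS' : Generates S' := hS.image hπ μ.mk_surjective
      -- Modulo `μ`, term `j + 2` is central, so commutators with term `j + 1` and associators with
      -- term `j` become central factors.
      have hcent : ∀ w, (commAssocCon E (j + 2)).r w 1 → IsCentral (μ.mk w) := by
        intro w hw
        refine hE'.isCentral (fun x => ?_) fun x y => ?_
        · obtain ⟨x, rfl⟩ := μ.mk_surjective x
          exact μ.mk_eq.2 (commAssocCon_comm hw x)
        · obtain ⟨x, rfl⟩ := μ.mk_surjective x
          obtain ⟨y, rfl⟩ := μ.mk_surjective y
          exact μ.mk_eq.2 (commAssocCon_assoc (commAssocCon_antitone _ hw) x y)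
      have hsm : ∀ a b, (commAssocCon E (j + 2)).r a b →
          ∃ z : Center μ.Quotient, μ.mk a = z • μ.mk b := by
        intro a b h
        have : (commAssocCon E (j + 2)).r (a / b) 1 := by
          have := LoopCon.div _ h (LoopCon.refl _ b)
          rwa [Loop.div_self''] at this
        exact ⟨(hcent _ this).toCenter, by
          rw [IsCentral.toCenter_smul, ← LoopCon.mk_mul, Loop.div_mul_cancel]⟩
      have hq2 : ∀ q, (commAssocCon E (j + 1)).r q 1 → ∀ x y,
          (μ.mk q * x) * y = μ.mk q * (x * y) := by
        intro q hq x y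
        obtain ⟨x, rfl⟩ := μ.mk_surjective x
        obtain ⟨y, rfl⟩ := μ.mk_surjective y
        exact μ.mk_eq.2 (commAssocCon_assoc hq x y)
      have hq1 : ∀ q, (commAssocCon E (j + 1)).r q 1 → ∀ x,
          ∃ z ∈ centerOf S', μ.mk q * x = z • (x * μ.mk q) := by
        intro q hq
        have : ∀ x, ∃ z : Center μ.Quotient, μ.mk q * x = z • (x * μ.mk q) := by
          intro x
          obtain ⟨x, rfl⟩ := μ.mk_surjective x
          exact hsm _ _ (commAssocCon_comm hq x)
        choose h hh using this
        obtain ⟨k, hk, hkq⟩ := ih (j + 1) (by omega) hq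
        obtain ⟨k', hk', e⟩ := exists_mltOf_image hπ hk
        have : ∀ x, ∃ z : Center μ.Quotient, k' x = z • (μ.mk q * x) := by
          intro x
          obtain ⟨x, rfl⟩ := μ.mk_surjective x
          rw [← e]
          exact hsm _ _ (hkq x)
        choose c hc using this
        exact fun x => ⟨h x, comm_factor_mem hE' hS' hh (hq2 q hq) hk' hc x, hh x⟩
      let β : LoopCon μ.Quotient := μ.push (commAssocCon E (j + 1)) fun h =>
        commAssocCon_antitone _ (commAssocCon_antitone _ h)
      have hβ : ∀ q, β.r q 1 → ∃ q', q = μ.mk q' ∧ (commAssocCon E (j + 1)).r q' 1 := by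
        intro q hq
        obtain ⟨q, rfl⟩ := μ.mk_surjective q
        exact ⟨q, rfl, hq⟩
      have hp : ∀ p, (commAssocCon E j).r p 1 → ∀ x y,
          ∃ z ∈ centerOf S', (μ.mk p * x) * y = z • (μ.mk p * (x * y)) := by
        intro p hp
        have : ∀ x y, ∃ z : Center μ.Quotient, (μ.mk p * x) * y = z • (μ.mk p * (x * y)) := by
          intro x y
          obtain ⟨x, rfl⟩ := μ.mk_surjective x
          obtain ⟨y, rfl⟩ := μ.mk_surjective y
          exact hsm _ _ (commAssocCon_assoc hp x y)
        choose f hf using this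
        obtain ⟨k, hk, hkp⟩ := ih j (by omega) hp
        obtain ⟨k', hk', e⟩ := exists_mltOf_image hπ hk
        refine fun x y => ⟨f x y, assoc_factor_mem hE' hS' β ?_ ?_ hf hk' ?_ x y, hf x y⟩
        · intro q hq
          obtain ⟨q, rfl, hq⟩ := hβ q hq
          exact hq1 q hq
        · intro q hq
          obtain ⟨q, rfl, hq⟩ := hβ q hq
          exact hq2 q hq
        · intro x
          obtain ⟨x, rfl⟩ := μ.mk_surjective x
          rw [← e]
          exact hkp x
      -- By `hq1` and `hp`, the congruence given by `centerOf S'` meets both conditions defining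
      -- term `j + 2`; hence `w` itself lies in `centerOf S'` modulo `μ`.
      obtain ⟨z, hz, e⟩ := hw ((LoopCon.ofCenter (centerOf S')).comap μ.mk hπ)
        ⟨fun q hq x => by
          obtain ⟨z, hz, e⟩ := hq1 q hq (μ.mk x)
          exact ⟨z⁻¹, inv_mem hz, by
            change μ.mk x * μ.mk q = z⁻¹ • (μ.mk q * μ.mk x)
            rw [e, inv_smul_smul]⟩,
        fun p hp' x y => by
          obtain ⟨z, hz, e⟩ := hp p hp' (μ.mk x) (μ.mk y)
          exact ⟨z⁻¹, inv_mem hz, by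
            change μ.mk p * (μ.mk x * μ.mk y) = z⁻¹ • ((μ.mk p * μ.mk x) * μ.mk y)
            rw [e, inv_smul_smul]⟩⟩
      obtain ⟨k, hk, hkz⟩ := exists_mltOf_lift hπ (inv_mem hz)
      refine ⟨k, hk, fun x => μ.mk_eq.1 ?_⟩
      have e2 : μ.mk w = z⁻¹ • (1 : μ.Quotient) := by
        rw [← μ.mk_one, e, inv_smul_smul]
      rw [hkz, μ.mk_mul, e2, Center.smul_mul, Loop.one_mul, ← map_inv]
      rfl

/-- In a nilpotent A-loop, the group generated by the translations by a generating set is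
transitive. -/
theorem HasInnerAut.exists_mltOf_apply_one (hE : HasInnerAut E) {θ : ℕ → LoopCon E} {n : ℕ}
    (hθ : IsCentralSeries θ n) {S : Set E} (hS : Generates S) (y : E) :
    ∃ g ∈ mltOf S, g 1 = y := by
  have key : ∀ j, ∃ g ∈ mltOf S, (commAssocCon E j).r (g 1) y := by
    intro j
    induction j with
    | zero => exact ⟨1, one_mem _, trivial⟩
    | succ j ih =>
      obtain ⟨g, hg, h⟩ := ih
      -- The error `y / g 1` lies in term `j`; translating by it corrects `g 1` modulo term `j + 1`.
      have hw : (commAssocCon E j).r (y / g 1) 1 := by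
        have := LoopCon.div _ (LoopCon.symm _ h) (LoopCon.refl _ (g 1))
        rwa [Loop.div_self''] at this
      obtain ⟨k, hk, hkw⟩ := exists_mltOf_commAssocCon hE hS j hw
      refine ⟨k * g, mul_mem hk hg, ?_⟩
      have := hkw (g 1)
      rwa [Loop.div_mul_cancel] at this
  obtain ⟨g, hg, h⟩ := key (2 * n)
  exact ⟨g, hg, hθ.bot _ _ (hθ.commAssocCon_le le_rfl h)⟩

end ALoopTransitive

/-- The translations come from a nilpotent group, and those by elements of any generating set
generate a transitive group. -/
structure IsControlled (m : ℕ) (E : Type u) [Loop E] : Prop where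
  nilpotent : ∃ (Γ : Type u) (_ : Group Γ) (ρ : Γ →* Equiv.Perm E),
    (∀ x, leftTrans x ∈ ρ.range ∧ rightTrans x ∈ ρ.range) ∧
      (⊤ : Subgroup Γ).lowerCentralSeries m = ⊥
  transitive : ∀ S : Set E, Generates S → ∀ y, ∃ g ∈ mltOf S, g 1 = y

theorem HasInnerAut.isControlled {E : Type u} [Loop E] (hE : HasInnerAut E) {θ : ℕ → LoopCon E}
    {n : ℕ} (hθ : IsCentralSeries θ n) : IsControlled (2 * n) E where
  nilpotent := ⟨mltOf (Set.univ : Set E), inferInstance, Subgroup.subtype _,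
    fun x => ⟨⟨⟨_, leftTrans_mem_mltOf (Set.mem_univ x)⟩, rfl⟩,
      ⟨⟨_, rightTrans_mem_mltOf (Set.mem_univ x)⟩, rfl⟩⟩, hE.mlt_nilpotent hθ⟩
  transitive _ hS := hE.exists_mltOf_apply_one hθ hS

/-! ### Moufang loops: autotopisms and the multiplication group. -/

section Moufang

variable {E : Type u} [Loop E]

/-- The inverse of an element, on the right. -/
def rinv (x : E) : E := Loop.ldiv x 1

@[simp] theorem mul_rinv (x : E) : x * rinv x = 1 := Loop.mul_ldiv_cancel x 1

namespace IsMoufang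

variable (h : IsMoufang E)
include h

theorem flexible (x y : E) : x * (y * x) = (x * y) * x := by simpa using h x y 1

theorem rinv_mul_cancel_left (x z : E) : rinv x * (x * z) = z := by
  have := h x (rinv x) z
  rw [mul_rinv, Loop.one_mul] at this
  exact Loop.mul_left_cancel this

theorem rinv_mul (x : E) : rinv x * x = 1 := by simpa using h.rinv_mul_cancel_left x 1

theorem rinv_rinv (x : E) : rinv (rinv x) = x :=
  Loop.mul_left_cancel (a := rinv x) (by rw [mul_rinv, h.rinv_mul])

theorem mul_rinv_cancel_left (x z : E) : x * (rinv x * z) = z := by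
  have := h.rinv_mul_cancel_left (rinv x) z
  rwa [h.rinv_rinv] at this

theorem mul_rinv_cancel_right (u x : E) : (u * x) * rinv x = u := by
  have := h x (Loop.ldiv x u) (rinv x)
  rwa [mul_rinv, Loop.mul_one, Loop.mul_ldiv_cancel, eq_comm] at this

theorem rinv_mul_cancel_right (u x : E) : (u * rinv x) * x = u := by
  have := h.mul_rinv_cancel_right u (rinv x)
  rwa [h.rinv_rinv] at this

theorem rinv_mul_rev (x y : E) : rinv (x * y) = rinv y * rinv x := by
  have h1 : y * rinv (x * y) = rinv x := by
    have := h.mul_rinv_cancel_right (rinv x) (x * y)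
    rwa [h.rinv_mul_cancel_left] at this
  rw [← h1, h.rinv_mul_cancel_left]

theorem right_moufang (x y z : E) : ((z * x) * y) * x = z * (x * (y * x)) := by
  have := congrArg rinv (h (rinv x) (rinv y) (rinv z))
  simpa only [h.rinv_mul_rev, h.rinv_rinv] using this

theorem left_autotopism (x a b : E) : (x * (a * x)) * (rinv x * b) = x * (a * b) := by
  rw [h.flexible, ← h, h.mul_rinv_cancel_left]

theorem right_autotopism (x a b : E) : (a * rinv x) * (x * (b * x)) = (a * b) * x := by
  rw [← h.right_moufang, h.rinv_mul_cancel_right]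

theorem middle_moufang (x y z : E) : (x * y) * (z * x) = x * ((y * z) * x) := by
  have := h.left_autotopism x (y * z) (rinv z)
  rw [h.mul_rinv_cancel_right] at this
  rw [← this, ← h.rinv_rinv (z * x), h.rinv_mul_rev z x, h.mul_rinv_cancel_right]

theorem isCentral {c : E} (h1 : ∀ x, c * x = x * c) (h2 : ∀ x y, (c * x) * y = c * (x * y)) :
    IsCentral c where
  comm := h1
  left := h2
  swap x y := by
    have hl : ∀ z, x * (x * z) = (x * x) * z := fun z => by simpa using h x 1 z
    have := h x c (rinv x * y)
    rw [← h1 x, h2, h2, ← hl, h.mul_rinv_cancel_left] at this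
    exact this

theorem leftTrans_inv (x : E) : (leftTrans x)⁻¹ = leftTrans (rinv x) := by
  refine inv_eq_of_mul_eq_one_right (Equiv.ext fun y => ?_)
  exact h.mul_rinv_cancel_left x y

theorem rightTrans_inv (x : E) : (rightTrans x)⁻¹ = rightTrans (rinv x) := by
  refine inv_eq_of_mul_eq_one_right (Equiv.ext fun y => ?_)
  exact h.rinv_mul_cancel_right y x

/-- A form of the middle Moufang identity. With its mirror image it shows that the elements whose
two translations lie in `mltOf S` are closed under products. -/
theorem leftTrans_mul (x y : E) :
    leftTrans (x * y) = leftTrans x * rightTrans x * leftTrans y * (rightTrans x)⁻¹ := by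
  rw [h.rightTrans_inv]
  refine Equiv.ext fun w => ?_
  simp only [Equiv.Perm.mul_apply, leftTrans_apply, rightTrans_apply]
  rw [← h.middle_moufang, h.rinv_mul_cancel_right]

theorem rightTrans_mul (z x : E) :
    rightTrans (z * x) = leftTrans x * rightTrans x * rightTrans z * (leftTrans x)⁻¹ := by
  rw [h.leftTrans_inv]
  refine Equiv.ext fun w => ?_
  simp only [Equiv.Perm.mul_apply, leftTrans_apply, rightTrans_apply]
  rw [← h.middle_moufang, h.mul_rinv_cancel_left]

/-- In a Moufang loop, the translations by a generating set generate all translations. -/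
theorem trans_mem_mltOf {S : Set E} (hS : Generates S) (w : E) :
    leftTrans w ∈ mltOf S ∧ rightTrans w ∈ mltOf S := by
  have hmul : ∀ x y : E, leftTrans x ∈ mltOf S ∧ rightTrans x ∈ mltOf S →
      leftTrans y ∈ mltOf S ∧ rightTrans y ∈ mltOf S →
      leftTrans (x * y) ∈ mltOf S ∧ rightTrans (x * y) ∈ mltOf S := by
    rintro x y ⟨lx, rx⟩ ⟨ly, ry⟩
    rw [h.leftTrans_mul, h.rightTrans_mul]
    exact ⟨mul_mem (mul_mem (mul_mem lx rx) ly) (inv_mem rx),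
      mul_mem (mul_mem (mul_mem ly ry) rx) (inv_mem ly)⟩
  have hinv : ∀ x : E, leftTrans x ∈ mltOf S ∧ rightTrans x ∈ mltOf S →
      leftTrans (rinv x) ∈ mltOf S ∧ rightTrans (rinv x) ∈ mltOf S := by
    rintro x ⟨lx, rx⟩
    rw [← h.leftTrans_inv, ← h.rightTrans_inv]
    exact ⟨inv_mem lx, inv_mem rx⟩
  refine hS {w | leftTrans w ∈ mltOf S ∧ rightTrans w ∈ mltOf S}
    ⟨?_, fun x hx y hy => hmul x y hx hy, ?_, ?_⟩
    (fun e he => ⟨leftTrans_mem_mltOf he, rightTrans_mem_mltOf he⟩) w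
  · have h1 : leftTrans (1 : E) = 1 := Equiv.ext fun x => Loop.one_mul x
    have h2 : rightTrans (1 : E) = 1 := Equiv.ext fun x => Loop.mul_one x
    exact ⟨h1 ▸ one_mem _, h2 ▸ one_mem _⟩
  · intro x hx y hy
    rw [Loop.ldiv_eq_iff.2 (h.mul_rinv_cancel_left x y).symm]
    exact hmul _ _ (hinv x hx) hy
  · intro x hx y hy
    rw [Loop.div_eq_iff'.2 (h.rinv_mul_cancel_right x y).symm]
    exact hmul _ _ hx (hinv y hy)

end IsMoufang

variable (E) in

/-- The group of autotopisms with components in the multiplication group. -/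
def autotopismGroup : Subgroup (Fin 3 → Equiv.Perm E) where
  carrier := {g | (∀ k, g k ∈ mltOf (Set.univ : Set E)) ∧ ∀ x y, g 0 x * g 1 y = g 2 (x * y)}
  one_mem' := ⟨fun _ => one_mem _, fun _ _ => rfl⟩
  mul_mem' := fun {g g'} hg hg' => ⟨fun k => mul_mem (hg.1 k) (hg'.1 k), fun x y => by
    simp only [Pi.mul_apply, Equiv.Perm.mul_apply]
    rw [hg.2, hg'.2]⟩
  inv_mem' := fun {g} hg => ⟨fun k => inv_mem (hg.1 k), fun x y => by
    simp only [Pi.inv_apply]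
    rw [Equiv.Perm.eq_inv_iff_eq, ← hg.2, perm_apply_inv, perm_apply_inv]⟩

/-- The autotopism equation turns into `c 0 x * c 1 y = c 2 (x * y)` for the central factors, which
forces each of the three to be affine. The whole triple is needed: one component alone gives no such
relation. -/
theorem autotopismGroup_nilpotent {θ : ℕ → LoopCon E} {n : ℕ} (hθ : IsCentralSeries θ n) :
    (⊤ : Subgroup (autotopismGroup E)).lowerCentralSeries (2 * n) = ⊥ := by
  refine lowerCentralSeries_eq_bot_of_affine (ι := Fin 3)
    (fun k => (Pi.evalMonoidHom _ k).comp (autotopismGroup E).subtype) (fun k g => g.2.1 k)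
    (fun g hg => Subtype.ext (funext hg)) hθ ?_
  intro i hi g c hc
  set π := (θ (i + 1)).mk
  have hπ : IsLoopHom π := LoopCon.mk_hom _
  have hc' : ∀ k x, π (g.1 k x) = c k x • π x := hc
  have key : ∀ x y, c 0 x * c 1 y = c 2 (x * y) := by
    intro x y
    have := congrArg π (g.2.2 x y)
    rw [hπ, hc', hc', hc', hπ, Center.smul_mul, Center.mul_smul', ← mul_smul,
      Center.smul_right_inj] at this
    exact this
  have h0 : ∀ x, c 0 x * c 1 1 = c 2 x := fun x => by rw [key, Loop.mul_one]
  have h1 : ∀ x, c 0 1 * c 1 x = c 2 x := fun x => by rw [key, Loop.one_mul]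
  have h2 : ∀ x y, c 2 (x * y) * c 2 1 = c 2 x * c 2 y := fun x y => by
    rw [← key, ← h0 1, ← h0 x, ← h1 y]
    simp only [mul_comm, mul_left_comm]
  intro k x y
  fin_cases k
  · have := h2 x y
    simp only [← h0] at this
    rw [mul_mul_mul_comm, mul_mul_mul_comm (c 0 x)] at this
    exact mul_right_cancel this
  · have := h2 x y
    simp only [← h1] at this
    rw [mul_mul_mul_comm, mul_mul_mul_comm (c 0 1) (c 1 x)] at this
    exact mul_left_cancel (a := c 0 1 * c 0 1) this
  · exact h2 x y

theorem IsMoufang.isControlled (h : IsMoufang E) {θ : ℕ → LoopCon E} {n : ℕ}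
    (hθ : IsCentralSeries θ n) : IsControlled (2 * n) E where
  nilpotent := by
    have hl : ∀ x : E, leftTrans x ∈ mltOf Set.univ := fun x => leftTrans_mem_mltOf (Set.mem_univ x)
    have hr : ∀ x : E, rightTrans x ∈ mltOf Set.univ :=
      fun x => rightTrans_mem_mltOf (Set.mem_univ x)
    refine ⟨autotopismGroup E, inferInstance,
      (Pi.evalMonoidHom _ 2).comp (autotopismGroup E).subtype, fun x => ⟨?_, ?_⟩,
      autotopismGroup_nilpotent hθ⟩
    -- Both translations occur as third components of autotopisms given by the Moufang identities.
    · refine ⟨⟨![leftTrans x * rightTrans x, leftTrans (rinv x), leftTrans x], ?_, ?_⟩, rfl⟩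
      · intro k
        fin_cases k
        exacts [mul_mem (hl x) (hr x), hl _, hl x]
      · exact h.left_autotopism x
    · refine ⟨⟨![rightTrans (rinv x), leftTrans x * rightTrans x, rightTrans x], ?_, ?_⟩, rfl⟩
      · intro k
        fin_cases k
        exacts [hr _, mul_mem (hl x) (hr x), hr x]
      · exact h.right_autotopism x
  transitive S hS y := ⟨leftTrans y, (h.trans_mem_mltOf hS y).1, Loop.mul_one y⟩

end Moufang
-- Substitution, and loops of terms modulo a family of valuations.
namespace Term

/-- Simultaneous substitution. -/
def subst (σ : ℕ → Term) : Term → Term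
  | var i => σ i
  | one => one
  | mul s t => mul (s.subst σ) (t.subst σ)
  | ldiv s t => ldiv (s.subst σ) (t.subst σ)
  | rdiv s t => rdiv (s.subst σ) (t.subst σ)

theorem eval_subst {M : Type v} [Loop M] (f : ℕ → M) (σ : ℕ → Term) (t : Term) :
    (t.subst σ).eval f = t.eval fun i => (σ i).eval f := by
  induction t with
  | var i => rfl
  | one => rfl
  | mul s t hs ht => simp only [subst, eval, hs, ht]
  | ldiv s t hs ht => simp only [subst, eval, hs, ht]
  | rdiv s t hs ht => simp only [subst, eval, hs, ht]

theorem eval_congr {M : Type v} [Loop M] {f g : ℕ → M} (t : Term) (h : ∀ i ∈ t.vars, f i = g i) :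
    t.eval f = t.eval g := by
  induction t with
  | var i => exact h i (by simp [vars])
  | one => rfl
  | mul s t hs ht | ldiv s t hs ht | rdiv s t hs ht =>
    simp only [eval, hs fun i hi => h i (Finset.mem_union_left _ hi),
      ht fun i hi => h i (Finset.mem_union_right _ hi)]

theorem map_eval {M : Type u} {N : Type v} [Loop M] [Loop N] {φ : M → N} (hφ : IsLoopHom φ)
    (f : ℕ → M) (t : Term) : φ (t.eval f) = t.eval fun i => φ (f i) := by
  induction t with
  | var i => rfl
  | one => exact hφ.map_one
  | mul s t hs ht => simp only [eval, hφ _ _, hs, ht]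
  | ldiv s t hs ht => simp only [eval, hφ.map_ldiv, hs, ht]
  | rdiv s t hs ht => simp only [eval, hφ.map_div, hs, ht]

theorem mem_vars_subst {σ : ℕ → Term} {t : Term} {j : ℕ} :
    j ∈ (t.subst σ).vars ↔ ∃ i ∈ t.vars, j ∈ (σ i).vars := by
  induction t with
  | var i => simp [subst, vars]
  | one => simp [subst, vars]
  | mul s t hs ht | ldiv s t hs ht | rdiv s t hs ht =>
    simp only [subst, vars, Finset.mem_union, hs, ht, or_and_right, exists_or]

end Term

namespace Identity

/-- Simultaneous substitution on both sides. -/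
def subst (σ : ℕ → Term) (e : Identity) : Identity := ⟨e.lhs.subst σ, e.rhs.subst σ⟩

theorem mem_vars_subst {σ : ℕ → Term} {e : Identity} {j : ℕ} :
    j ∈ (e.subst σ).vars ↔ ∃ i ∈ e.vars, j ∈ (σ i).vars := by
  simp only [vars, subst, Finset.mem_union, Term.mem_vars_subst, or_and_right, exists_or]

theorem eval_iff_of_eq {e : Identity} {M : Type v} [Loop M] {f g : ℕ → M}
    (h : ∀ i ∈ e.vars, f i = g i) :
    e.lhs.eval f = e.rhs.eval f ↔ e.lhs.eval g = e.rhs.eval g := by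
  rw [Term.eval_congr e.lhs fun i hi => h i (Finset.mem_union_left _ hi),
    Term.eval_congr e.rhs fun i hi => h i (Finset.mem_union_right _ hi)]

theorem HoldsIn.subst {e : Identity} {M : Type v} [Loop M] (h : e.HoldsIn M) (σ : ℕ → Term) :
    (e.subst σ).HoldsIn M := fun f => by
  simpa only [Identity.subst, Term.eval_subst] using h _

theorem HoldsIn.of_surjective {e : Identity} {M : Type u} {N : Type v} [Loop M] [Loop N]
    {φ : M → N} (hφ : IsLoopHom φ) (hs : Function.Surjective φ) (h : e.HoldsIn M) :
    e.HoldsIn N := fun f => by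
  obtain ⟨g, rfl⟩ : ∃ g : ℕ → M, f = fun i => φ (g i) :=
    ⟨fun i => (hs (f i)).choose, funext fun i => (hs (f i)).choose_spec.symm⟩
  rw [← Term.map_eval hφ, ← Term.map_eval hφ, h]

end Identity

section TermQuotient

variable {ι : Type u} {M : ι → Type v} [∀ i, Loop (M i)] (f : ∀ i, ℕ → M i)

/-- Terms modulo equality of the values under a family of valuations. -/
def TermQuotient : Type := Quot fun s t : Term => ∀ i, s.eval (f i) = t.eval (f i)

namespace TermQuotient

/-- The class of a term. -/
def mk (t : Term) : TermQuotient f := Quot.mk _ t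

theorem mk_surjective : Function.Surjective (mk f) := Quot.exists_rep

theorem sound {s t : Term} (h : ∀ i, s.eval (f i) = t.eval (f i)) : mk f s = mk f t := Quot.sound h

/-- The value of a class under one of the valuations. -/
def ev (i : ι) : TermQuotient f → M i := Quot.lift (fun t => t.eval (f i)) fun _ _ h => h i

instance : Loop (TermQuotient f) where
  mul := Quot.map₂ Term.mul (fun _ _ _ h i => by simp only [Term.eval, h i])
    (fun _ _ _ h i => by simp only [Term.eval, h i])
  one := mk f Term.one
  div := Quot.map₂ Term.rdiv (fun _ _ _ h i => by simp only [Term.eval, h i])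
    (fun _ _ _ h i => by simp only [Term.eval, h i])
  ldiv := Quot.map₂ Term.ldiv (fun _ _ _ h i => by simp only [Term.eval, h i])
    (fun _ _ _ h i => by simp only [Term.eval, h i])
  mul_div_cancel := by rintro ⟨x⟩ ⟨y⟩; exact sound f fun i => Loop.mul_div_cancel _ _
  div_mul_cancel := by rintro ⟨x⟩ ⟨y⟩; exact sound f fun i => Loop.div_mul_cancel _ _
  ldiv_mul_cancel := by rintro ⟨x⟩ ⟨y⟩; exact sound f fun i => Loop.ldiv_mul_cancel _ _
  mul_ldiv_cancel := by rintro ⟨x⟩ ⟨y⟩; exact sound f fun i => Loop.mul_ldiv_cancel _ _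
  one_mul := by rintro ⟨x⟩; exact sound f fun i => Loop.one_mul _
  mul_one := by rintro ⟨x⟩; exact sound f fun i => Loop.mul_one _

theorem ev_mk (i : ι) (t : Term) : ev f i (mk f t) = t.eval (f i) := rfl

theorem ev_hom (i : ι) : IsLoopHom (ev f i) := by rintro ⟨x⟩ ⟨y⟩; rfl

theorem eval_mk (σ : ℕ → Term) (t : Term) : t.eval (fun i => mk f (σ i)) = mk f (t.subst σ) := by
  induction t with
  | var i => rfl
  | one => rfl
  | mul s t hs ht => simp only [Term.eval, hs, ht]; rfl
  | ldiv s t hs ht => simp only [Term.eval, hs, ht]; rfl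
  | rdiv s t hs ht => simp only [Term.eval, hs, ht]; rfl

theorem holdsIn {e : Identity} (h : ∀ i, e.HoldsIn (M i)) : e.HoldsIn (TermQuotient f) := by
  intro g
  obtain ⟨σ, rfl⟩ : ∃ σ : ℕ → Term, g = fun i => mk f (σ i) :=
    ⟨fun i => (mk_surjective f (g i)).choose,
      funext fun i => (mk_surjective f (g i)).choose_spec.symm⟩
  rw [eval_mk, eval_mk]
  exact sound f fun i => by rw [Term.eval_subst, Term.eval_subst, h i]

theorem generates {X : Finset ℕ} (hX : ∀ i, ∀ j ∉ X, f i j = 1) :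
    Generates ((fun j => mk f (Term.var j)) '' X) := by
  rintro K hK hXK ⟨t⟩
  induction t with
  | var j =>
    by_cases hj : j ∈ X
    · exact hXK ⟨j, hj, rfl⟩
    · have : mk f (Term.var j) = 1 := sound f fun i => hX i j hj
      change mk f (Term.var j) ∈ K
      rw [this]
      exact hK.one_mem
  | one => exact hK.one_mem
  | mul s t hs ht => exact hK.mul_mem _ hs _ ht
  | ldiv s t hs ht => exact hK.ldiv_mem _ hs _ ht
  | rdiv s t hs ht => exact hK.div_mem _ hs _ ht

end TermQuotient

end TermQuotient

/-! ### Reduction to finitely many identities in `m` variables. -/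

section Reduction

variable {m : ℕ} {B : Set Identity}
  (hB : ∀ (E : Type) [Loop E], (∀ b ∈ B, b.HoldsIn E) → IsControlled m E)
include hB

/-- A word in more than `m` variables, trivial whenever one of its variables is, is trivial. -/
theorem eval_eq_one_of_controlled {M : Type} [Loop M] (hM : ∀ b ∈ B, b.HoldsIn M) (w : Term)
    (X : Finset ℕ) (hX : m < X.card) (f : ℕ → M)
    (hf : ∀ g : ℕ → M, (∃ i ∈ X, g i = 1) → w.eval g = 1) :
    w.eval (fun i => if i ∈ X then f i else 1) = 1 := by
  obtain ⟨Γ, _, ρ, hρ, hΓ⟩ := (hB M hM).nilpotent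
  -- At the vertex `ω` only the variables in `ω` keep their values. `TermQuotient fc` evaluates
  -- terms at all vertices at once.
  let fc : Finset ℕ → ℕ → M := fun ω i => if i ∈ ω ∧ i ∈ X then f i else 1
  let F := NSeries.lower Γ
  have hF1 : ∀ γ : Γ, γ ∈ F.toFun 1 := fun γ => Subgroup.mem_top γ
  have hlift : ∀ h ∈ mltOf ((fun j => TermQuotient.mk fc (Term.var j)) '' (X : Set ℕ)),
      ∃ g ∈ (F.cube X.toList).toFun 0, ∀ ω y,
        TermQuotient.ev fc ω (h y) = ρ (g ω) (TermQuotient.ev fc ω y) := by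
    intro h hh
    induction hh using mltOf_induction with
    | left e he =>
      obtain ⟨j, hj, rfl⟩ := he
      obtain ⟨γ, hγ⟩ := (hρ (f j)).1
      refine ⟨_, F.mem_cube_face X.nodup_toList (i := j) (hF1 γ), fun ω y => ?_⟩
      rw [leftTrans_apply, TermQuotient.ev_hom, TermQuotient.ev_mk]
      by_cases hω : j ∈ ω
      · simp [hω, hγ, Term.eval, fc, Finset.mem_coe.1 hj]
      · simp [hω, Term.eval, fc]
    | right e he =>
      obtain ⟨j, hj, rfl⟩ := he
      obtain ⟨γ, hγ⟩ := (hρ (f j)).2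
      refine ⟨_, F.mem_cube_face X.nodup_toList (i := j) (hF1 γ), fun ω y => ?_⟩
      rw [rightTrans_apply, TermQuotient.ev_hom, TermQuotient.ev_mk]
      by_cases hω : j ∈ ω
      · simp [hω, hγ, Term.eval, fc, Finset.mem_coe.1 hj]
      · simp [hω, Term.eval, fc]
    | one => exact ⟨1, one_mem _, fun ω y => by simp⟩
    | mul h h' _ _ ih ih' =>
      obtain ⟨g, hg, e⟩ := ih
      obtain ⟨g', hg', e'⟩ := ih'
      exact ⟨g * g', mul_mem hg hg', fun ω y => by
        rw [Equiv.Perm.mul_apply, e, e', Pi.mul_apply, map_mul, Equiv.Perm.mul_apply]⟩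
    | inv h _ ih =>
      obtain ⟨g, hg, e⟩ := ih
      exact ⟨g⁻¹, inv_mem hg, fun ω y => by
        rw [Pi.inv_apply, map_inv, Equiv.Perm.eq_inv_iff_eq, ← e, perm_apply_inv]⟩
  -- Transitivity is used in `TermQuotient fc` rather than in `M`, so that one product of
  -- translations yields the value of `w` at every vertex and lifts to a polynomial map `g`.
  obtain ⟨h, hh, hw⟩ := (hB (TermQuotient fc) fun b hb =>
    TermQuotient.holdsIn fc fun _ => hM b hb).transitive _
    (TermQuotient.generates fc (X := X) fun ω j hj => if_neg fun h => hj h.2)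
    (TermQuotient.mk fc w)
  obtain ⟨g, hg, e⟩ := hlift h hh
  have hgw : ∀ ω, ρ (g ω) 1 = w.eval (fc ω) := fun ω => by
    rw [← TermQuotient.ev_mk, ← hw, e, (TermQuotient.ev_hom fc ω).map_one]
  let S : Subgroup Γ := (MulAction.stabilizer (Equiv.Perm M) (1 : M)).comap ρ
  have hS : ∀ γ, γ ∈ S ↔ ρ γ 1 = 1 := fun γ => Iff.rfl
  obtain ⟨s, hs, t, ht, est⟩ := F.cube_top_mem S X.nodup_toList hg fun ω _ hω => by
    obtain ⟨i, hi, hiω⟩ := hω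
    rw [hS, hgw]
    exact hf _ ⟨i, Finset.mem_toList.1 hi, if_neg fun h => hiω h.1⟩
  -- Degree `X.card > m` of `F` is at least index `m` of the lower central series, because of the
  -- shift by one in `NSeries.lower`.
  have ht1 : t = 1 := by
    have hle : F.toFun (0 + X.toList.length) ≤ (⊤ : Subgroup Γ).lowerCentralSeries m :=
      Subgroup.lowerCentralSeries_antitone _ (by rw [Finset.length_toList]; omega)
    have := hle ht
    rwa [hΓ, Subgroup.mem_bot] at this
  rw [ht1, mul_one, Finset.toList_toFinset] at est
  have hfin : w.eval (fc X) = 1 := by rw [← hgw, est]; exact hs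
  simpa only [fc, and_self] using hfin

/-- Induction on the number of variables. Up to `m` variables can be renamed; beyond that, setting a
variable to `1` leaves an identity with fewer variables, so `lhs \ rhs` meets the hypothesis of
`eval_eq_one_of_controlled`. Working in `TermQuotient` moves `M` to the lowest universe, where `hB`
applies. -/
theorem holdsIn_of_few_variables {Q : Type u} [Loop Q] {M : Type v} [Loop M]
    (hM : ∀ b ∈ B, b.HoldsIn M)
    (hQM : ∀ e : Identity, e.HoldsIn Q → e.vars ⊆ Finset.range m → e.HoldsIn M)
    (e : Identity) (he : e.HoldsIn Q) : e.HoldsIn M := by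
  intro f
  let f' : Unit → ℕ → M := fun _ => f
  suffices h : ∀ k, ∀ e : Identity, e.HoldsIn Q → e.vars.card = k →
      e.HoldsIn (TermQuotient f') by
    have := congrArg (TermQuotient.ev f' ())
      (h _ e he rfl fun i => TermQuotient.mk f' (Term.var i))
    rwa [Term.map_eval (TermQuotient.ev_hom f' ()), Term.map_eval (TermQuotient.ev_hom f' ())]
      at this
  have hM' : ∀ b ∈ B, b.HoldsIn (TermQuotient f') := fun b hb =>
    TermQuotient.holdsIn f' fun _ => hM b hb
  intro k
  induction k using Nat.strong_induction_on with
  | _ k ih =>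
    intro e he hk
    by_cases hkm : k ≤ m
    · refine TermQuotient.holdsIn f' fun _ => ?_
      let s : ℕ → ℕ := fun i => if h : i ∈ e.vars then (e.vars.equivFin ⟨i, h⟩ : ℕ) else 0
      have hs : ∀ i ∈ e.vars, s i < m := fun i hi => by
        simp only [s, dif_pos hi]
        exact lt_of_lt_of_le (Fin.is_lt _) (by omega)
      have h1 : (e.subst fun i => Term.var (s i)).HoldsIn M := by
        refine hQM _ (he.subst _) fun j hj => ?_
        obtain ⟨i, hi, hj⟩ := Identity.mem_vars_subst.1 hj
        rw [Term.vars, Finset.mem_singleton] at hj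
        rw [hj, Finset.mem_range]
        exact hs i hi
      intro g
      let g' : ℕ → M := fun j => if h : j < e.vars.card then g (e.vars.equivFin.symm ⟨j, h⟩) else 1
      have hg' : ∀ i ∈ e.vars, g' (s i) = g i := fun i hi => by
        simp [g', s, dif_pos hi]
      have := h1 g'
      simp only [Identity.subst, Term.eval_subst] at this
      exact (Identity.eval_iff_of_eq hg').1 this
    · intro g
      have hw := eval_eq_one_of_controlled hB hM' (Term.ldiv e.lhs e.rhs) e.vars (by omega) g ?_
      · rw [Term.eval, Loop.ldiv_eq_one_iff] at hw
        exact (Identity.eval_iff_of_eq fun i hi => if_pos hi).1 hw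
      · rintro g ⟨i, hi, hgi⟩
        rw [Term.eval, Loop.ldiv_eq_one_iff]
        let σ : ℕ → Term := fun j => if j = i then Term.one else Term.var j
        have hlt : (e.subst σ).vars.card < k := by
          rw [← hk]
          refine Finset.card_lt_card ⟨fun j hj => ?_, fun h => ?_⟩
          · obtain ⟨j', hj', hj⟩ := Identity.mem_vars_subst.1 hj
            by_cases hji : j' = i
            · simp [σ, hji, Term.vars] at hj
            · simp only [σ, if_neg hji, Term.vars, Finset.mem_singleton] at hj
              rwa [hj]
          · obtain ⟨j', hj', hj⟩ := Identity.mem_vars_subst.1 (h hi)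
            by_cases hji : j' = i
            · simp [σ, hji, Term.vars] at hj
            · simp only [σ, if_neg hji, Term.vars, Finset.mem_singleton] at hj
              exact hji hj.symm
        have := ih _ hlt _ (he.subst σ) rfl g
        simp only [Identity.subst, Term.eval_subst] at this
        have hσ : (fun j => (σ j).eval g) = g := funext fun j => by
          by_cases hji : j = i
          · simp [σ, hji, Term.eval, hgi]
          · simp [σ, hji, Term.eval]
        rwa [hσ] at this

/-- Finitely many identities in `m` variables imply all the others. -/
theorem exists_finite_of_controlled (I : Set Identity) (hI : ∀ e ∈ I, e.vars ⊆ Finset.range m) :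
    ∃ S : Finset Identity, (S : Set Identity) ⊆ I ∧ ∀ e ∈ I, ∀ (M : Type) [Loop M],
      (∀ b ∈ B, b.HoldsIn M) → (∀ b ∈ S, b.HoldsIn M) → e.HoldsIn M := by
  classical
  -- All valuations of the first `m` variables in loops satisfying `B`; `F` below is then the
  -- relatively free loop on `m` generators.
  let ι := {p : Σ (M : Type) (_ : Loop M), ℕ → M // (∀ b ∈ B, @Identity.HoldsIn b p.1 p.2.1) ∧
    ∀ i ∉ Finset.range m, p.2.2 i = @One.one p.1 p.2.1.toOne}
  let M : ι → Type := fun p => p.1.1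
  let _ : ∀ i, Loop (M i) := fun p => p.1.2.1
  let f : ∀ i, ℕ → M i := fun p => p.1.2.2
  have hMB : ∀ i, ∀ b ∈ B, b.HoldsIn (M i) := fun i => i.2.1
  have hf1 : ∀ i, ∀ j ∉ Finset.range m, f i j = 1 := fun i => i.2.2
  let F := TermQuotient f
  have hF : IsControlled m F := hB F fun b hb => TermQuotient.holdsIn f fun i => hMB i b hb
  let G : Set F := (fun j => TermQuotient.mk f (Term.var j)) '' (Finset.range m : Set ℕ)
  have hG : Generates G := TermQuotient.generates f hf1
  obtain ⟨Γ, _, ρ, hρ, hΓ⟩ := hF.nilpotent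
  choose l hl using fun x => (hρ x).1
  choose r hr using fun x => (hρ x).2
  let x : ℕ → F := fun j => TermQuotient.mk f (Term.var j)
  let T : Finset Γ := (Finset.range m).image (fun j => l (x j)) ∪
    (Finset.range m).image (fun j => r (x j))
  -- Lifts of the translations by the generators already induce all of `mltOf G`, and they generate
  -- a finitely generated nilpotent, hence Noetherian, group.
  let Γ' := Subgroup.closure (T : Set Γ)
  have hρG : ∀ g ∈ Γ', ρ g ∈ mltOf G := by
    change Γ' ≤ (mltOf G).comap ρ
    rw [Subgroup.closure_le]
    intro g hg
    rcases Finset.mem_union.1 (Finset.mem_coe.1 hg) with hg | hg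
    · obtain ⟨j, hj, rfl⟩ := Finset.mem_image.1 hg
      change ρ (l (x j)) ∈ mltOf G
      rw [hl]
      exact leftTrans_mem_mltOf ⟨j, hj, rfl⟩
    · obtain ⟨j, hj, rfl⟩ := Finset.mem_image.1 hg
      change ρ (r (x j)) ∈ mltOf G
      rw [hr]
      exact rightTrans_mem_mltOf ⟨j, hj, rfl⟩
  have hGρ : mltOf G ≤ Γ'.map ρ := by
    refine (Subgroup.closure_le _).2 ?_
    rintro _ (⟨_, ⟨j, hj, rfl⟩, rfl⟩ | ⟨_, ⟨j, hj, rfl⟩, rfl⟩)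
    · exact ⟨l (x j), Subgroup.subset_closure (Finset.mem_coe.2
        (Finset.mem_union_left _ (Finset.mem_image_of_mem _ hj))), hl (x j)⟩
    · exact ⟨r (x j), Subgroup.subset_closure (Finset.mem_coe.2
        (Finset.mem_union_right _ (Finset.mem_image_of_mem _ hj))), hr (x j)⟩
  have hΓ' : (⊤ : Subgroup Γ').lowerCentralSeries m = ⊥ := by
    rw [← Subgroup.map_eq_bot_iff_of_injective _ Γ'.subtype_injective, eq_bot_iff, ← hΓ]
    rw [Subgroup.top_subtype_lowerCentralSeries]
    exact Subgroup.lowerCentralSeries_mono m le_top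
  have : WellFoundedGT (Subgroup Γ') := wellFoundedGT_subgroup_of_nilpotent m hΓ'
  -- The elements moving `1` to a term that is trivial in every loop satisfying `S`. It is a
  -- subgroup because elements of `mltOf G` descend to permutations of each image, where it becomes
  -- the stabilizer of `1`. A maximal `stab S` with `S` finite gives the required set.
  let stab : Set Identity → Subgroup Γ' := fun S =>
    { carrier := {g | ∀ i, (∀ b ∈ S, b.HoldsIn (M i)) → TermQuotient.ev f i (ρ g 1) = 1}
      one_mem' := fun i _ => by
        rw [Subgroup.coe_one, map_one ρ]
        exact (TermQuotient.ev_hom f i).map_one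
      mul_mem' := fun {g h} hg hh i hi => by
        obtain ⟨g', -, e⟩ := exists_mltOf_image (TermQuotient.ev_hom f i) (hρG g g.2)
        have h1 := (e 1).symm.trans (hg i hi)
        rw [(TermQuotient.ev_hom f i).map_one] at h1
        rw [Subgroup.coe_mul, map_mul, Equiv.Perm.mul_apply, e, hh i hi, h1]
      inv_mem' := fun {g} hg i hi => by
        obtain ⟨g', -, e⟩ := exists_mltOf_image (TermQuotient.ev_hom f i) (hρG g g.2)
        have h1 := (e 1).symm.trans (hg i hi)
        rw [(TermQuotient.ev_hom f i).map_one] at h1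
        have h2 := e ((ρ g)⁻¹ 1)
        rw [perm_apply_inv, (TermQuotient.ev_hom f i).map_one, ← h1] at h2
        rw [Subgroup.coe_inv, map_inv, ← g'.injective h2] }
  obtain ⟨_, ⟨S, hS, rfl⟩, hmax⟩ := wellFounded_gt.has_min
    {K : Subgroup Γ' | ∃ S : Finset Identity, (S : Set Identity) ⊆ I ∧ stab S = K}
    ⟨_, ∅, by simp, rfl⟩
  refine ⟨S, hS, fun e he N _ hNB hNS => ?_⟩
  have hle : stab S ≤ stab (insert e S : Finset Identity) := fun g hg i hi =>
    hg i fun b hb => hi b (Finset.mem_coe.2 (Finset.mem_insert_of_mem hb))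
  have hmem : stab (insert e S : Finset Identity) ≤ stab S := by
    refine (eq_of_le_of_not_lt hle (hmax _ ⟨insert e S, ?_, rfl⟩)).ge
    rw [Finset.coe_insert]
    exact Set.insert_subset he hS
  obtain ⟨h, hh, hw⟩ := hF.transitive G hG (TermQuotient.mk f (Term.ldiv e.lhs e.rhs))
  obtain ⟨g, hg, rfl⟩ := hGρ hh
  have hgs : (⟨g, hg⟩ : Γ') ∈ stab (insert e S : Finset Identity) := by
    intro i hi
    change TermQuotient.ev f i (ρ g 1) = 1
    rw [hw, TermQuotient.ev_mk, Term.eval, Loop.ldiv_eq_one_iff]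
    exact hi e (Finset.mem_coe.2 (Finset.mem_insert_self _ _)) _
  intro a
  let a' : ℕ → N := fun j => if j ∈ Finset.range m then a j else 1
  let i : ι := ⟨⟨N, inferInstance, a'⟩, hNB, fun j hj => if_neg hj⟩
  have := hmem hgs i hNS
  change TermQuotient.ev f i (ρ g 1) = 1 at this
  rw [hw, TermQuotient.ev_mk, Term.eval, Loop.ldiv_eq_one_iff] at this
  exact (Identity.eval_iff_of_eq fun j hj => if_pos (hI e he hj)).1 this

/-- If the loops with identities `B` are controlled, then an identity basis is obtained from `B`
by adding finitely many identities in the first `m` variables. -/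
theorem exists_finite_basis (Q : Type u) [Loop Q] (hQ : ∀ b ∈ B, b.HoldsIn Q) :
    ∃ S : Finset Identity, (∀ e ∈ S, e.vars ⊆ Finset.range m) ∧
      IsBasisOfIdentities.{u, v} Q (B ∪ S) := by
  obtain ⟨S, hS, h⟩ := exists_finite_of_controlled hB
    {e | e.HoldsIn Q ∧ e.vars ⊆ Finset.range m} fun e he => he.2
  refine ⟨S, fun e he => (hS he).2, ?_, ?_⟩
  · rintro b (hb | hb)
    exacts [hQ b hb, (hS hb).1]
  · intro e he M _ hM
    refine holdsIn_of_few_variables hB (fun b hb => hM b (Or.inl hb)) (fun e he hem a => ?_) e he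
    let a' : Unit → ℕ → M := fun _ => a
    have := congrArg (TermQuotient.ev a' ()) (h e ⟨he, hem⟩ (TermQuotient a')
      (fun b hb => TermQuotient.holdsIn a' fun _ => hM b (Or.inl hb))
      (fun b hb => TermQuotient.holdsIn a' fun _ => hM b (Or.inr hb))
      fun i => TermQuotient.mk a' (Term.var i))
    rwa [Term.map_eval (TermQuotient.ev_hom a' ()), Term.map_eval (TermQuotient.ev_hom a' ())]
      at this

end Reduction
-- Commutator and associator words.
namespace Term

/-- The valuation sending the first three variables to `a`, `b`, `c`. -/
def triple {α : Type*} (a b c : α) : ℕ → α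
  | 0 => a
  | 1 => b
  | _ => c

/-- The ternary operation on terms is given by substitution into a term in three variables. -/
structure IsTernary (A : Term → Term → Term → Term) : Prop where
  eq_subst : ∀ a b c, A a b c = (A (var 0) (var 1) (var 2)).subst (triple a b c)
  vars_eq : (A (var 0) (var 1) (var 2)).vars = {0, 1, 2}

/-- The ternary operation on a loop induced by one on terms. -/
def ternaryOp (A : Term → Term → Term → Term) {M : Type v} [Loop M] (a b c : M) : M :=
  (A (var 0) (var 1) (var 2)).eval (triple a b c)

theorem map_ternaryOp (A : Term → Term → Term → Term) {M : Type u} {N : Type v} [Loop M] [Loop N]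
    {φ : M → N} (hφ : IsLoopHom φ) (a b c : M) :
    φ (ternaryOp A a b c) = ternaryOp A (φ a) (φ b) (φ c) := by
  rw [ternaryOp, map_eval hφ, ternaryOp]
  congr 1
  funext i
  rcases i with _ | _ | i <;> rfl

theorem IsTernary.eval {A : Term → Term → Term → Term} (hA : IsTernary A) {M : Type v} [Loop M]
    (f : ℕ → M) (a b c : Term) :
    (A a b c).eval f = ternaryOp A (a.eval f) (b.eval f) (c.eval f) := by
  rw [hA.eq_subst, eval_subst, ternaryOp]
  congr 1
  funext i
  rcases i with _ | _ | i <;> rfl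

theorem IsTernary.vars {A : Term → Term → Term → Term} (hA : IsTernary A) (a b c : Term) :
    (A a b c).vars = a.vars ∪ b.vars ∪ c.vars := by
  ext j
  rw [hA.eq_subst, mem_vars_subst, hA.vars_eq]
  simp [triple]

theorem isTernary_assocMu : IsTernary assocMu where
  eq_subst _ _ _ := rfl
  vars_eq := by decide

theorem isTernary_assocAlpha : IsTernary assocAlpha where
  eq_subst _ _ _ := rfl
  vars_eq := by decide

theorem isTernary_assocBeta : IsTernary assocBeta where
  eq_subst _ _ _ := rfl
  vars_eq := by decide

/-- The commutator of two terms. -/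
def commTerm (a b : Term) : Term := ldiv (mul a b) (mul b a)

/-- Iterated associators and commutators; `true` stands for an associator. -/
def mixedWord (A : Term → Term → Term → Term) : List Bool → Term
  | [] => var 0
  | true :: l => A (mixedWord A l) (var (2 * l.length + 1)) (var (2 * l.length + 2))
  | false :: l => commTerm (mixedWord A l) (var (2 * l.length + 1))

theorem mixedWord_replicate (A : Term → Term → Term → Term) (n : ℕ) :
    mixedWord A (List.replicate n true) = assocWord A n := by
  induction n with
  | zero => rfl
  | succ n ih => rw [List.replicate_succ, mixedWord, ih, List.length_replicate, assocWord]

variable {A : Term → Term → Term → Term} (hA : IsTernary A)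
include hA

theorem IsTernary.vars_mixedWord_subset (l : List Bool) :
    (mixedWord A l).vars ⊆ Finset.range (2 * l.length + 1) := by
  induction l with
  | nil => simp [mixedWord, Term.vars]
  | cons b l ih =>
    intro j hj
    rw [List.length_cons, Finset.mem_range]
    have hl : j ∈ (mixedWord A l).vars → j < 2 * l.length + 1 := fun h => Finset.mem_range.1 (ih h)
    cases b with
    | true =>
      simp only [mixedWord, hA.vars, Term.vars, Finset.mem_union, Finset.mem_singleton] at hj
      rcases hj with (hj | hj) | hj
      · have := hl hj
        omega
      all_goals omega
    | false =>
      simp only [mixedWord, commTerm, Term.vars, Finset.mem_union, Finset.mem_singleton] at hj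
      rcases hj with (hj | hj) | (hj | hj)
      · have := hl hj
        omega
      · omega
      · omega
      · have := hl hj
        omega

/-- An associator adds two variables, a commutator only one: its numbering skips `2 * l.length + 2`.
-/
theorem IsTernary.card_vars_mixedWord_le (l : List Bool) :
    (mixedWord A l).vars.card ≤ 1 + l.length + l.count true := by
  induction l with
  | nil => simp [mixedWord, Term.vars]
  | cons b l ih =>
    cases b with
    | true =>
      rw [mixedWord, hA.vars, List.length_cons, List.count_cons_self]
      refine (Finset.card_union_le _ _).trans ?_
      have := Finset.card_union_le (mixedWord A l).vars (var (2 * l.length + 1)).vars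
      simp only [Term.vars, Finset.card_singleton] at this ⊢
      omega
    | false =>
      have e : (mixedWord A (false :: l)).vars = (mixedWord A l).vars ∪ {2 * l.length + 1} := by
        ext j
        simp only [mixedWord, commTerm, Term.vars, Finset.mem_union]
        tauto
      rw [e]
      refine (Finset.card_union_le _ _).trans ?_
      simp only [List.length_cons, Finset.card_singleton, List.count_cons]
      simp
      omega

theorem IsTernary.vars_assocWord (n : ℕ) :
    (assocWord A n).vars = Finset.range (2 * n + 1) := by
  induction n with
  | zero => rfl
  | succ n ih =>
    rw [assocWord, hA.vars, ih]
    ext j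
    simp only [Term.vars, Finset.mem_union, Finset.mem_range, Finset.mem_singleton]
    omega

end Term

open Term

/-- The identities `w = 1` for all iterated associators and commutators of weight `n`. -/
def mixedIdentities (A : Term → Term → Term → Term) (n : ℕ) : Set Identity :=
  (fun l => ⟨mixedWord A l, Term.one⟩) '' {l : List Bool | l.length = n}

theorem mixedIdentities_finite (A : Term → Term → Term → Term) (n : ℕ) :
    (mixedIdentities A n).Finite :=
  (List.finite_length_eq Bool n).image _

theorem assocIdentity_mem_mixedIdentities (A : Term → Term → Term → Term) (n : ℕ) :
    assocIdentity A n ∈ mixedIdentities A n :=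
  ⟨List.replicate n true, List.length_replicate, by
    simp only [mixedWord_replicate]
    rfl⟩

theorem Term.IsTernary.card_vars_of_mem {A : Term → Term → Term → Term} (hA : IsTernary A) {n : ℕ}
    {e : Identity} (he : e ∈ mixedIdentities A n) (hne : e ≠ assocIdentity A n) :
    e.vars.card ≤ 2 * n := by
  obtain ⟨l, hl, rfl⟩ := he
  have hl : l.length = n := hl
  have hc : l.count true < n := by
    refine lt_of_le_of_ne (hl ▸ List.count_le_length) fun h => hne ?_
    have : l = List.replicate n true := by
      rw [← hl, List.eq_replicate_length]
      rw [← hl] at h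
      exact fun b hb => (List.count_eq_length.1 h b hb).symm
    subst this
    simp only [mixedWord_replicate]
    rfl
  have := hA.card_vars_mixedWord_le l
  simp only [Identity.vars, Term.vars, Finset.union_empty]
  omega

/-! ### Mixed words, the central series and the basis. -/

section LowerCentral

variable {Q : Type u} [Loop Q] {A : Term → Term → Term → Term}
  (hcen : ∀ (E : Type u) [Loop E] (a b c : E), IsCentral a → ternaryOp A a b c = 1)
include hcen

theorem ternaryOp_mem_lowerCentralSeries {k : ℕ} {a : Q} (ha : a ∈ lowerCentralSeries Q k)
    (b c : Q) : ternaryOp A a b c ∈ lowerCentralSeries Q (k + 1) := by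
  rintro K ⟨hK, hc⟩
  rw [← hK.con_mk_eq_one, map_ternaryOp A hK.con.mk_hom]
  exact hcen _ _ _ _ ((hc a ha).isCentral_mk hK)

theorem eval_mixedWord_mem_lowerCentralSeries (hA : IsTernary A) (f : ℕ → Q) (l : List Bool) :
    (mixedWord A l).eval f ∈ lowerCentralSeries Q l.length := by
  induction l with
  | nil => trivial
  | cons b l ih =>
    cases b with
    | true =>
      rw [mixedWord, hA.eval]
      exact ternaryOp_mem_lowerCentralSeries hcen ih _ _
    | false =>
      rintro K ⟨hK, hc⟩
      have := ((hc _ ih).isCentral_mk hK).comm (hK.con.mk (f (2 * l.length + 1)))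
      rw [← hK.con_mk_eq_one, mixedWord, commTerm, Term.eval, hK.con.mk_hom.map_ldiv,
        Loop.ldiv_eq_one_iff]
      exact this

theorem mixedIdentities_holdsIn (hA : IsTernary A) {n : ℕ}
    (hQ : lowerCentralSeries Q n = {1}) : ∀ b ∈ mixedIdentities A n, b.HoldsIn Q := by
  rintro _ ⟨l, hl, rfl⟩ f
  have hl : l.length = n := hl
  have := eval_mixedWord_mem_lowerCentralSeries hcen hA f l
  rw [hl, hQ] at this
  exact this

end LowerCentral

section UpperCentral

variable {A : Term → Term → Term → Term} (hA : IsTernary A) {D : Set Identity}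

include hA in
-- A word with `k` letters missing takes values in the `k`-th upper centre: extending it by a
-- commutator or an associator with fresh variables lands in the previous centre, and by `hcen` this
-- is centrality. The empty word is an arbitrary element, and `n` letters are missing.
theorem isCentralSeries_of_mixedIdentities {M : Type u} [Loop M]
    (hcen : ∀ (E : Type u) [Loop E], (∀ b ∈ D, b.HoldsIn E) → ∀ a : E, (∀ x, a * x = x * a) →
      (∀ x y, ternaryOp A a x y = 1) → IsCentral a) {n : ℕ}
    (hD : ∀ b ∈ D, b.HoldsIn M) (hM : ∀ b ∈ mixedIdentities A n, b.HoldsIn M) :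
    IsCentralSeries (fun i => upperCon M (n - i)) n := by
  have key : ∀ k, ∀ l : List Bool, l.length + k = n → ∀ f : ℕ → M,
      (upperCon M k).r ((mixedWord A l).eval f) 1 := by
    intro k
    induction k with
    | zero => exact fun l hl f => hM _ ⟨l, hl, rfl⟩ f
    | succ k ih =>
      intro l hl f
      rw [upperCon_succ_r_one]
      set π := (upperCon M k).mk with hπ
      have hl1 : ∀ x y, (mixedWord A l).eval (fun i => if i = 2 * l.length + 1 then x else
          if i = 2 * l.length + 2 then y else f i) = (mixedWord A l).eval f := fun x y =>
        Term.eval_congr _ fun i hi => by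
          have := Finset.mem_range.1 (hA.vars_mixedWord_subset l hi)
          rw [if_neg (by omega), if_neg (by omega)]
      refine hcen _ (fun b hb => (hD b hb).of_surjective (LoopCon.mk_hom _)
        (LoopCon.mk_surjective _)) _ (fun x => ?_) fun x y => ?_
      · obtain ⟨x, rfl⟩ := LoopCon.mk_surjective _ x
        have := ih (false :: l) (by rw [List.length_cons]; omega)
          (fun i => if i = 2 * l.length + 1 then x else if i = 2 * l.length + 2 then x else f i)
        rw [LoopCon.r_one_iff, mixedWord, commTerm, Term.eval, IsLoopHom.map_ldiv (LoopCon.mk_hom _),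
          Loop.ldiv_eq_one_iff] at this
        simp only [Term.eval, hl1, ↓reduceIte] at this
        exact this
      · obtain ⟨x, rfl⟩ := LoopCon.mk_surjective _ x
        obtain ⟨y, rfl⟩ := LoopCon.mk_surjective _ y
        have := ih (true :: l) (by rw [List.length_cons]; omega)
          (fun i => if i = 2 * l.length + 1 then x else if i = 2 * l.length + 2 then y else f i)
        rw [LoopCon.r_one_iff, mixedWord, hA.eval, map_ternaryOp A (LoopCon.mk_hom _)] at this
        simp only [Term.eval, hl1] at this
        simpa using this
  exact isCentralSeries_upperCon fun x => key n [] (by simp) fun _ => x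

/-- For `n < 2` the identities in `D` may have more than `2 * n` variables, but the loop is then
trivial or an abelian group, so they need not be in the basis. -/
theorem holdsIn_of_mixedIdentities {M : Type u} [Loop M]
    (hab : ∀ (E : Type u) [Loop E], (∀ a b : E, a * b = b * a) →
      (∀ a b c : E, ternaryOp A a b c = 1) → ∀ b ∈ D, b.HoldsIn E) {n : ℕ} (hn : n < 2)
    (hM : ∀ b ∈ mixedIdentities A n, b.HoldsIn M) : ∀ b ∈ D, b.HoldsIn M := by
  interval_cases n
  · have h : ∀ x : M, x = 1 := fun x => hM _ ⟨[], rfl, rfl⟩ fun _ => x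
    exact hab M (fun a b => by rw [h a, h b]) fun a b c => h _
  · refine hab M (fun a b => ?_) fun a b c => ?_
    · exact Loop.ldiv_eq_one_iff.1 (hM _ ⟨[false], rfl, rfl⟩ (triple a b b))
    · have := hM _ ⟨[true], rfl, rfl⟩ (triple a b c)
      exact this

include hA in

/-- A finite basis consisting of one identity in `2 * n + 1` variables and identities in at most
`2 * n` variables, for a nilpotent loop in a variety with suitable properties. -/
theorem exists_basis_of_nilpotent (hD : D.Finite) (hDv : ∀ e ∈ D, e.vars.card ≤ 4)
    (hcen : ∀ (E : Type) [Loop E], (∀ b ∈ D, b.HoldsIn E) → ∀ a : E, (∀ x, a * x = x * a) →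
      (∀ x y, ternaryOp A a x y = 1) → IsCentral a)
    (hab : ∀ (E : Type) [Loop E], (∀ a b : E, a * b = b * a) →
      (∀ a b c : E, ternaryOp A a b c = 1) → ∀ b ∈ D, b.HoldsIn E)
    (hcontr : ∀ (E : Type) [Loop E], (∀ b ∈ D, b.HoldsIn E) → ∀ (θ : ℕ → LoopCon E) (n : ℕ),
      IsCentralSeries θ n → IsControlled (2 * n) E)
    (Q : Type u) [Loop Q] (hQD : ∀ b ∈ D, b.HoldsIn Q)
    (hQcen : ∀ (E : Type u) [Loop E] (a b c : E), IsCentral a → ternaryOp A a b c = 1)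
    {n : ℕ} (hQ : lowerCentralSeries Q n = {1}) :
    (assocIdentity A n).vars.card = 2 * n + 1 ∧
      ∃ S : Set Identity, S.Finite ∧ (∀ e ∈ S, e.vars.card ≤ 2 * n) ∧
        IsBasisOfIdentities.{u, v} Q ({assocIdentity A n} ∪ S) := by
  refine ⟨by simp [Identity.vars, assocIdentity, hA.vars_assocWord, Term.vars], ?_⟩
  -- Members of `D` have up to `4` variables, which is within `2 * n` exactly from `n = 2` on.
  let B : Set Identity := mixedIdentities A n ∪ {e | e ∈ D ∧ 2 ≤ n}
  have hBf : B.Finite := (mixedIdentities_finite A n).union (hD.subset fun e he => he.1)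
  have hB : ∀ (E : Type) [Loop E], (∀ b ∈ B, b.HoldsIn E) → IsControlled (2 * n) E := by
    intro E _ hE
    have hmix : ∀ b ∈ mixedIdentities A n, b.HoldsIn E := fun b hb => hE b (Or.inl hb)
    have hDE : ∀ b ∈ D, b.HoldsIn E := by
      by_cases hn : 2 ≤ n
      · exact fun b hb => hE b (Or.inr ⟨hb, hn⟩)
      · exact holdsIn_of_mixedIdentities hab (by omega) hmix
    exact hcontr E hDE _ n (isCentralSeries_of_mixedIdentities hA hcen hDE hmix)
  obtain ⟨S, hS, hbasis⟩ := exists_finite_basis.{u, v} hB Q (by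
    rintro b (hb | hb)
    exacts [mixedIdentities_holdsIn hQcen hA hQ b hb, hQD b hb.1])
  refine ⟨(B \ {assocIdentity A n}) ∪ S, (hBf.subset Set.sdiff_subset).union S.finite_toSet,
    ?_, ?_⟩
  · rintro e (⟨he | he, hne⟩ | he)
    · exact hA.card_vars_of_mem he hne
    · have := hDv e he.1
      have := he.2
      omega
    · simpa using Finset.card_le_card (hS e he)
  · have hmem : {assocIdentity A n} ⊆ B :=
      Set.singleton_subset_iff.2 (Or.inl (assocIdentity_mem_mixedIdentities A n))
    rw [← Set.union_assoc, Set.union_sdiff_cancel hmem]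
    exact hbasis

end UpperCentral

/-! ### The Moufang and A-loop varieties, and the conclusion. -/

section Varieties

/-- The Moufang identity. -/
def moufangIdentity : Identity :=
  ⟨mul (var 0) (mul (var 1) (mul (var 0) (var 2))),
    mul (mul (mul (var 0) (var 1)) (var 0)) (var 2)⟩

theorem moufangIdentity_holdsIn {E : Type u} [Loop E] : moufangIdentity.HoldsIn E ↔ IsMoufang E :=
  ⟨fun h x y z => h (triple x y z), fun h f => h (f 0) (f 1) (f 2)⟩

/-- The term for `T(x)`. -/
def termT (x a : Term) : Term := ldiv x (mul a x)

/-- The term for `R(x, y)`. -/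
def termR (x y a : Term) : Term := rdiv (mul (mul a x) y) (mul x y)

/-- The term for `L(x, y)`. -/
def termL (x y a : Term) : Term := ldiv (mul x y) (mul x (mul y a))

/-- The identities expressing that the generating inner mappings are automorphisms. -/
def innerAutIdentities : Set Identity :=
  {⟨termT (var 2) (mul (var 0) (var 1)), mul (termT (var 2) (var 0)) (termT (var 2) (var 1))⟩,
    ⟨termR (var 2) (var 3) (mul (var 0) (var 1)),
      mul (termR (var 2) (var 3) (var 0)) (termR (var 2) (var 3) (var 1))⟩,
    ⟨termL (var 2) (var 3) (mul (var 0) (var 1)),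
      mul (termL (var 2) (var 3) (var 0)) (termL (var 2) (var 3) (var 1))⟩}

theorem innerAutIdentities_holdsIn {E : Type u} [Loop E] :
    (∀ b ∈ innerAutIdentities, b.HoldsIn E) ↔ HasInnerAut E := by
  simp only [innerAutIdentities, Set.mem_insert_iff, Set.mem_singleton_iff, forall_eq_or_imp,
    forall_eq]
  constructor
  · rintro ⟨hT, hR, hL⟩
    let v : E → E → E → E → ℕ → E := fun a b x y i =>
      if i = 0 then a else if i = 1 then b else if i = 2 then x else y
    exact ⟨fun x a b => hT (v a b x x), fun x y a b => hR (v a b x y),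
      fun x y a b => hL (v a b x y)⟩
  · intro h
    exact ⟨fun f => h.T (f 2) (f 0) (f 1), fun f => h.R (f 2) (f 3) (f 0) (f 1),
      fun f => h.L (f 2) (f 3) (f 0) (f 1)⟩

theorem ternaryOp_assocMu_eq_one {E : Type u} [Loop E] {a b c : E} :
    ternaryOp assocMu a b c = 1 ↔ (a * b) * c = a * (b * c) :=
  Loop.ldiv_eq_one_iff.trans eq_comm

theorem ternaryOp_assocAlpha_eq_one {E : Type u} [Loop E] {a b c : E} :
    ternaryOp assocAlpha a b c = 1 ↔ (a * b) * c = a * (b * c) :=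
  Loop.ldiv_eq_one_iff.trans (eq_comm.trans Loop.div_eq_iff')

theorem ternaryOp_assocBeta_eq_one {E : Type u} [Loop E] {a b c : E} :
    ternaryOp assocBeta a b c = 1 ↔ c * (b * a) = (c * b) * a := by
  change Loop.ldiv (c * b) (c * (b * a)) / a = 1 ↔ _
  rw [Loop.div_eq_iff', Loop.one_mul, Loop.ldiv_eq_iff]

theorem HasInnerAut.of_comm_assoc {E : Type u} [Loop E] (hc : ∀ a b : E, a * b = b * a)
    (ha : ∀ a b c : E, (a * b) * c = a * (b * c)) : HasInnerAut E := by
  have hT : ∀ x a : E, innerT x a = a := fun x a => Loop.mul_left_cancel (a := x) (by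
    rw [mul_innerT, hc])
  have hR : ∀ x y a : E, innerR x y a = a := fun x y a => Loop.mul_right_cancel (a := x * y) (by
    rw [innerR_mul, ha])
  have hL : ∀ x y a : E, innerL x y a = a := fun x y a => Loop.mul_left_cancel (a := x * y) (by
    rw [mul_innerL, ha])
  exact ⟨by simp [hT], by simp [hR], by simp [hL]⟩

/-- The type `β` associator tests associativity with `a` on the right. Since `innerT x` fixes `a`
and is an automorphism, this moves to the left. -/
theorem HasInnerAut.isCentral_of_right {E : Type u} [Loop E] (h : HasInnerAut E) {a : E}
    (h1 : ∀ x, a * x = x * a) (h2 : ∀ x y, x * (y * a) = (x * y) * a) : IsCentral a := by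
  refine h.isCentral h1 fun y x => ?_
  have hTa : innerT x a = a := Loop.mul_left_cancel (a := x) (by rw [mul_innerT, h1])
  have := congrArg (x * ·) (h.T x y a)
  rw [mul_innerT, hTa, h2, mul_innerT] at this
  rw [h1 y, h1 (y * x), this]

/-- The theorem for A-loops, for an associator whose vanishing characterizes associativity. -/
theorem exists_basis_of_isALoop {A : Term → Term → Term → Term} (hA : IsTernary A)
    (hcen : ∀ (E : Type) [Loop E], HasInnerAut E → ∀ a : E, (∀ x, a * x = x * a) →
      (∀ x y, ternaryOp A a x y = 1) → IsCentral a)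
    (hassoc : ∀ (E : Type) [Loop E], (∀ a b c : E, ternaryOp A a b c = 1) →
      ∀ a b c : E, (a * b) * c = a * (b * c))
    (hQcen : ∀ (E : Type u) [Loop E] (a b c : E), IsCentral a → ternaryOp A a b c = 1)
    (Q : Type u) [Loop Q] (hQA : IsALoop Q) {n : ℕ} (hQ : lowerCentralSeries Q n = {1}) :
    (assocIdentity A n).vars.card = 2 * n + 1 ∧
      ∃ S : Set Identity, S.Finite ∧ (∀ e ∈ S, e.vars.card ≤ 2 * n) ∧
        IsBasisOfIdentities.{u, v} Q ({assocIdentity A n} ∪ S) := by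
  refine exists_basis_of_nilpotent hA (D := innerAutIdentities) (by simp [innerAutIdentities]) ?_
    (fun E _ hE => hcen E (innerAutIdentities_holdsIn.1 hE))
    (fun E _ hc ha => innerAutIdentities_holdsIn.2 (HasInnerAut.of_comm_assoc hc (hassoc E ha)))
    (fun E _ hE _ _ hθ => (innerAutIdentities_holdsIn.1 hE).isControlled hθ)
    Q (innerAutIdentities_holdsIn.2 hQA.hasInnerAut) hQcen hQ
  simp only [innerAutIdentities, Set.mem_insert_iff, Set.mem_singleton_iff, forall_eq_or_imp,
    forall_eq]
  decide

end Varieties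

end LoopTheory

theorem theorem5p4 (Q : Type u) [LoopTheory.Loop Q] (n : ℕ)
    (hQ : LoopTheory.IsCentrallyNilpotentOfClass Q n) :
    (LoopTheory.IsMoufang Q →
      (LoopTheory.assocIdentity LoopTheory.Term.assocMu n).vars.card = 2 * n + 1 ∧
      ∃ S : Set LoopTheory.Identity, S.Finite ∧ (∀ e ∈ S, e.vars.card ≤ 2 * n) ∧
        LoopTheory.IsBasisOfIdentities.{u, v} Q
          ({LoopTheory.assocIdentity LoopTheory.Term.assocMu n} ∪ S)) ∧
    (LoopTheory.IsALoop Q →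
      ∀ A ∈ ({LoopTheory.Term.assocAlpha, LoopTheory.Term.assocBeta} :
          Set (LoopTheory.Term → LoopTheory.Term → LoopTheory.Term → LoopTheory.Term)),
        (LoopTheory.assocIdentity A n).vars.card = 2 * n + 1 ∧
        ∃ S : Set LoopTheory.Identity, S.Finite ∧ (∀ e ∈ S, e.vars.card ≤ 2 * n) ∧
          LoopTheory.IsBasisOfIdentities.{u, v} Q
            ({LoopTheory.assocIdentity A n} ∪ S)) := by
  open LoopTheory LoopTheory.Term in
  refine ⟨fun hM => ?_, fun hA A hAA => ?_⟩
  · refine exists_basis_of_nilpotent isTernary_assocMu (D := {moufangIdentity}) (by simp) ?_ ?_ ?_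
      ?_ Q ?_ ?_ hQ.1
    · simp only [Set.mem_singleton_iff, forall_eq]
      decide
    · simp only [Set.mem_singleton_iff, forall_eq, moufangIdentity_holdsIn,
        ternaryOp_assocMu_eq_one]
      exact fun E _ hE _ => hE.isCentral
    · simp only [Set.mem_singleton_iff, forall_eq, moufangIdentity_holdsIn,
        ternaryOp_assocMu_eq_one]
      exact fun E _ hc ha x y z => by rw [ha, ha]
    · simp only [Set.mem_singleton_iff, forall_eq, moufangIdentity_holdsIn]
      exact fun E _ hE _ _ hθ => hE.isControlled hθ
    · simpa only [Set.mem_singleton_iff, forall_eq, moufangIdentity_holdsIn] using hM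
    · exact fun E _ a b c h => ternaryOp_assocMu_eq_one.2 (h.left b c)
  · rcases hAA with rfl | rfl
    · refine exists_basis_of_isALoop isTernary_assocAlpha ?_ ?_ ?_ Q hA hQ.1
      · exact fun E _ hE a h1 h2 => hE.isCentral h1 fun x y => ternaryOp_assocAlpha_eq_one.1 (h2 x y)
      · exact fun E _ h a b c => ternaryOp_assocAlpha_eq_one.1 (h a b c)
      · exact fun E _ a b c h => ternaryOp_assocAlpha_eq_one.2 (h.left b c)
    · refine exists_basis_of_isALoop isTernary_assocBeta ?_ ?_ ?_ Q hA hQ.1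
      · exact fun E _ hE a h1 h2 => hE.isCentral_of_right h1 fun x y =>
          ternaryOp_assocBeta_eq_one.1 (h2 y x)
      · exact fun E _ h a b c => (ternaryOp_assocBeta_eq_one.1 (h c b a)).symm
      · exact fun E _ a b c h => ternaryOp_assocBeta_eq_one.2 (by
          rw [← h.comm b, h.swap, h.comm])
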